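/- Let $\mathbb T=[0,1)$ and $1\le p<\infty$. Let $L_p(\mathbb T)$ be the set of $1$-periodic measurable finite-valued (real or complex) functions $f$ with $\|f\|_p=\left(\int_0^1|f(x)|^p\,dx\right)^{1/p}<\infty$, where functions that coincide almost everywhere are not identified. For $s\in\mathbb N$ let $W_p^s(\mathbb T)$ be the set of $1$-periodic functions $g$ such that $g^{(s-1)}$ is absolutely continuous and $g^{(s)}\in L_p(\mathbb T)$, and let $$\omega_s(f,\delta)_p=\sup_{0<h<\delta}\|\Delta_h^sf\|_p,\qquad \Delta_h^sf(x)=\sum_{\nu=0}^s(-1)^\nu\binom s\nu f(x+(s-\nu)h).$$ For $r\in\mathbb N$ and $\delta>0$ let $$f_{\delta,r}(x)=(-1)^{r+1}\binom{2r}{r}^{-1}\frac2\delta\int_{-\delta/2}^{\delta/2}\sum_{\nu=0}^{r-1}(-1)^\nu\binom{2r}{\nu}f\left(x+\frac{r-\nu}{r}t\right)dt .$$ Let $\gamma\in(0,1]$ and, for every $n\in\mathbb N$, let $X_n=(x_{k,n})_{k=1}^n$ satisfy $0\le x_{1,n}<\dots<x_{n,n}<1$ and $x_{k+1,n}-x_{k,n}\ge\gamma/n$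 for $k=1,\dots,n$, where $x_{n+1,n}=1+x_{1,n}$. Put $\|f\|_{\ell_p(X_n)}=\left(\frac1n\sum_{k=1}^n|f(x_{k,n})|^p\right)^{1/p}$ and $$\mathcal K_s(f,X_n)_p=\inf_{g\in W_p^s(\mathbb T)}\left(\|f-g\|_{\ell_p(X_n)}+\|f-g\|_p+n^{-s}\|g^{(s)}\|_p\right).$$ **Theorem.** Let $1\le p<\infty$, $r,s\in\mathbb N$, $s\le 2r$, and $\gamma\in(0,1]$. There are constants $c,C>0$, depending only on $p,r,s,\gamma$, such that for all $(X_n)_{n\in\mathbb N}$ as above, all $f\in L_p(\mathbb T)$ and all $n\in\mathbb N$, $$c\left(\|f_{\gamma/n,r}-f\|_{\ell_p(X_n)}+\omega_s(f,1/n)_p\right)\le\mathcal K_s(f,X_n)_p\le C\left(\|f_{\gamma/n,r}-f\|_{\ell_p(X_n)}+\omega_s(f,1/n)_p\right).$$ -/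

import Mathlib

open MeasureTheory
open scoped ENNReal

noncomputable section

namespace SemiDiscrete

variable {𝕜 : Type*} [RCLike 𝕜]

/-- The integral norm `‖f‖_p` over one period, with values in `[0, ∞]`. -/
def normLp (p : ℝ) (f : ℝ → 𝕜) : ℝ≥0∞ :=
  eLpNorm f (ENNReal.ofReal p) (volume.restrict (Set.Ico (0 : ℝ) 1))

/-- `f ∈ L_p(𝕋)`: a 1-periodic, (Lebesgue) measurable, finite-valued function with `‖f‖_p < ∞`.
Functions are not identified when they agree almost everywhere. -/
def IsLp (p : ℝ) (f : ℝ → 𝕜) : Prop :=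
  Function.Periodic f 1 ∧
    MemLp f (ENNReal.ofReal p) (volume.restrict (Set.Ico (0 : ℝ) 1))

/-- `g ∈ W_p^s(𝕋)` (for `s ≥ 1`): `g` is 1-periodic and `s - 1` times continuously differentiable,
`g^{(s-1)}` is absolutely continuous, and `g^{(s)}`, which then exists almost everywhere,
belongs to `L_p(𝕋)`. -/
def IsSobolev (p : ℝ) (s : ℕ) (g : ℝ → 𝕜) : Prop :=
  Function.Periodic g 1 ∧
    ContDiff ℝ ((s - 1 : ℕ) : WithTop ℕ∞) g ∧
    (∀ a b : ℝ, AbsolutelyContinuousOnInterval (iteratedDeriv (s - 1) g) a b) ∧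
    IsLp p (iteratedDeriv s g)

/-- The discrete semi-norm `‖f‖_{ℓ_p(X)} = ((1/n) ∑_k |f(x_k)|^p)^{1/p}` for `n ≥ 1` points. -/
def normDiscrete (p : ℝ) {n : ℕ} (x : Fin n → ℝ) (f : ℝ → 𝕜) : ℝ≥0∞ :=
  ((n : ℝ≥0∞)⁻¹ * ∑ k : Fin n, ‖f (x k)‖ₑ ^ p) ^ (1 / p)

/-- The difference `Δ_h^r f(x) = ∑_{ν=0}^r (-1)^ν binom(r,ν) f(x + (r - ν) h)`. -/
def diff (r : ℕ) (h : ℝ) (f : ℝ → 𝕜) (x : ℝ) : 𝕜 :=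
  ∑ ν ∈ Finset.range (r + 1),
    ((-1 : ℝ) ^ ν * (r.choose ν : ℝ)) • f (x + ((r : ℝ) - (ν : ℝ)) * h)

/-- The integral modulus of smoothness `ω_r(f, δ)_p = sup_{0 < h < δ} ‖Δ_h^r f‖_p`. -/
def modulus (r : ℕ) (f : ℝ → 𝕜) (δ : ℝ) (p : ℝ) : ℝ≥0∞ :=
  ⨆ h ∈ Set.Ioo (0 : ℝ) δ, normLp p (diff r h f)

/-- The generalized Steklov average `f_{δ,r}`. -/
def steklov (δ : ℝ) (r : ℕ) (f : ℝ → 𝕜) (x : ℝ) : 𝕜 :=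
  ((-1 : ℝ) ^ (r + 1) * ((2 * r).choose r : ℝ)⁻¹ * (2 / δ)) •
    ∫ t in (-(δ / 2))..(δ / 2), ∑ ν ∈ Finset.range r,
      ((-1 : ℝ) ^ ν * ((2 * r).choose ν : ℝ)) • f (x + ((r : ℝ) - (ν : ℝ)) / (r : ℝ) * t)

/-- The semi-discrete `K`-functional
`inf_{g ∈ W_p^s} (‖f - g‖_{ℓ_p(X)} + ‖f - g‖_p + n^{-s} ‖g^{(s)}‖_p)`. -/
def semiK (p : ℝ) (s : ℕ) {n : ℕ} (x : Fin n → ℝ) (f : ℝ → 𝕜) : ℝ≥0∞ :=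
  ⨅ (g : ℝ → 𝕜) (_ : IsSobolev p s g),
    normDiscrete p x (f - g) + normLp p (f - g) +
      ((n : ℝ≥0∞) ^ s)⁻¹ * normLp p (iteratedDeriv s g)

/-- The cyclic successor of the `k`-th node: `x_{k+1}`, where `x_{n+1} = 1 + x_1`. -/
def nextNode {n : ℕ} (x : Fin n → ℝ) (k : Fin n) : ℝ :=
  if h : (k : ℕ) + 1 < n then x ⟨(k : ℕ) + 1, h⟩
  else 1 + x ⟨0, lt_of_le_of_lt (Nat.zero_le _) k.isLt⟩

/-- The sets `X_n = {x_{1,n} < ... < x_{n,n}} ⊂ [0, 1)` are separated with parameter `γ`: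
`x_{k+1,n} - x_{k,n} ≥ γ / n` for all `n` and `k`, cyclically. -/
def IsNodeSystem (γ : ℝ) (X : (n : ℕ) → Fin n → ℝ) : Prop :=
  ∀ n : ℕ, StrictMono (X n) ∧ (∀ k, X n k ∈ Set.Ico (0 : ℝ) 1) ∧
    ∀ k, γ / (n : ℝ) ≤ nextNode (X n) k - X n k

end SemiDiscrete

end

/-!
The equivalence rests on three estimates, all with constants depending only on `p, r, s, γ`. Write
`δ = γ / n` and `A f` for the Steklov average `f_{δ,r}`.

* *Boundedness.* `A f` at a node is dominated by the mean of `|f|` over the window of width `δ`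
  around the node. By the separation of the nodes these windows are disjoint modulo `1`, so that
  Hölder's inequality gives `‖A f‖_{ℓ_p(X_n)} ≤ K ‖f‖_p` (`IsNodeSystem.normDiscrete_le`,
  `enorm_steklov_le`).
* *Approximation of smooth functions.* `A g - g` is a mean of central differences of order `2 r`
  whose stencils stay in the window (`steklov_sub_self`). Since `s ≤ 2 r`, the error at a node is at
  most `K δ ^ s` times the mean of `|g^{(s)}|` over the window, which gives
  `‖A g - g‖_{ℓ_p(X_n)} ≤ K n ^ {-s} ‖g^{(s)}‖_p` (`enorm_steklov_sub_self_le`).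
* *The classical `K`-functional.* `ω_s(f, 1/n)_p` is at most
  `2 ^ s ‖f - g‖_p + s n ^ {-s} ‖g^{(s)}‖_p` for every `g` (`modulus_le`), and some `g` satisfies
  `‖f - g‖_p ≤ ω_s(f, 1/n)_p` and `‖g^{(s)}‖_p ≤ K n ^ s ω_s(f, 1/n)_p` (`exists_isSobolev_approx`).

The lower bound for `𝒦_s` follows from `A f - f = A (f - g) + (A g - g) + (g - f)` for arbitrary
`g`, the upper bound from the same identity solved for `f - g`, with the `g` of the third estimate.

That `g` is a combination of `(s + 1)`-fold averages of `f` over steps `j h`, `1 ≤ j ≤ s`. One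
average makes `f` continuous and the others give a classical `s`-th derivative, which is a
combination of averaged difference quotients of order `s`. The coefficients are those of `Δ_h^s`,
so that `f - g` is up to sign an average of `Δ_τ^s f` over steps `τ ≤ (s + 1) h < 1/n`, to which
Minkowski's inequality applies (`normLp_sum_average_iterate_le`).
-/

namespace SemiDiscrete

variable {𝕜 : Type*} [RCLike 𝕜]

/-! ### Integrals of periodic functions over a period -/

lemma setLIntegral_Ioc_of_periodic {Φ : ℝ → ℝ≥0∞} (hΦ : Function.Periodic Φ 1) (a : ℝ) :
    ∫⁻ x in Set.Ioc a (a + 1), Φ x = ∫⁻ x in Set.Ico (0 : ℝ) 1, Φ x := by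
  have key := (isAddFundamentalDomain_Ioc (zero_lt_one (α := ℝ)) a).setLIntegral_eq
    (isAddFundamentalDomain_Ioc (zero_lt_one (α := ℝ)) 0) Φ (by
      rintro ⟨g, hg⟩ x
      obtain ⟨k, rfl⟩ := AddSubgroup.mem_zmultiples_iff.mp hg
      have := hΦ.zsmul k x
      simpa [AddSubgroup.vadd_def, add_comm] using this)
  rw [key, zero_add, setLIntegral_congr Ico_ae_eq_Ioc]

lemma setLIntegral_comp_add_right_of_periodic {Φ : ℝ → ℝ≥0∞} (hΦ : Function.Periodic Φ 1)
    (t : ℝ) :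
    ∫⁻ x in Set.Ico (0 : ℝ) 1, Φ (x + t) = ∫⁻ x in Set.Ico (0 : ℝ) 1, Φ x := by
  have h := (measurePreserving_add_right volume t).setLIntegral_comp_preimage_emb
    (measurableEmbedding_addRight t) Φ (Set.Ico t (t + 1))
  have hs : (fun x : ℝ => x + t) ⁻¹' Set.Ico t (t + 1) = Set.Ico 0 1 := by
    ext x
    simp only [Set.mem_preimage, Set.mem_Ico]
    constructor <;> rintro ⟨h1, h2⟩ <;> constructor <;> linarith
  rw [hs] at h
  rw [h, setLIntegral_congr Ico_ae_eq_Ioc, setLIntegral_Ioc_of_periodic hΦ]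

/-! ### Functions in `L_p` of the circle -/

lemma ofReal_ne_zero_of_one_le {p : ℝ} (hp : 1 ≤ p) : ENNReal.ofReal p ≠ 0 := by
  simp; linarith

lemma one_le_ofReal {p : ℝ} (hp : 1 ≤ p) : 1 ≤ ENNReal.ofReal p := by
  simpa using hp

lemma normLp_rpow {p : ℝ} (hp : 1 ≤ p) (f : ℝ → 𝕜) :
    normLp p f ^ p = ∫⁻ x in Set.Ico (0 : ℝ) 1, ‖f x‖ₑ ^ p := by
  rw [normLp, eLpNorm_eq_lintegral_rpow_enorm_toReal (ofReal_ne_zero_of_one_le hp)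
    ENNReal.ofReal_ne_top, ENNReal.toReal_ofReal (by linarith), ← ENNReal.rpow_mul,
    one_div_mul_cancel (by linarith), ENNReal.rpow_one]

lemma normLp_le_iff {p : ℝ} (hp : 1 ≤ p) (f : ℝ → 𝕜) (M : ℝ≥0∞) :
    normLp p f ≤ M ↔ ∫⁻ x in Set.Ico (0 : ℝ) 1, ‖f x‖ₑ ^ p ≤ M ^ p := by
  rw [← normLp_rpow hp, ENNReal.rpow_le_rpow_iff (by linarith)]

lemma normLp_comp_add_right {p : ℝ} (hp : 1 ≤ p) {f : ℝ → 𝕜} (hf : Function.Periodic f 1)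
    (t : ℝ) : normLp p (fun x => f (x + t)) = normLp p f := by
  have h := setLIntegral_comp_add_right_of_periodic (Φ := fun x => ‖f x‖ₑ ^ p)
    (fun x => by simp only [hf x]) t
  have hp' : p ≠ 0 := by linarith
  apply (ENNReal.rpow_left_injective hp')
  simp only [normLp_rpow hp, h]

namespace IsLp

variable {p : ℝ} {f g : ℝ → 𝕜}

/-- A function in `L_p(𝕋)` is measurable on the whole line, by periodicity. -/
lemma aestronglyMeasurable (hf : IsLp p f) : AEStronglyMeasurable f volume := by
  rw [← Measure.restrict_univ (μ := volume), ← iUnion_Ico_intCast ℝ,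
    aestronglyMeasurable_iUnion_iff]
  intro n
  have h0 := hf.2.1
  have hmp : MeasurePreserving (fun x : ℝ => x - n)
      (volume.restrict (Set.Ico (n : ℝ) (n + 1))) (volume.restrict (Set.Ico 0 1)) := by
    have h := (measurePreserving_sub_right volume (n : ℝ)).restrict_preimage_emb
      (measurableEmbedding_subRight (n : ℝ)) (Set.Ico 0 1)
    convert h using 2
    ext x
    simp only [Set.mem_preimage, Set.mem_Ico]
    constructor <;> rintro ⟨h1, h2⟩ <;> constructor <;> linarith
  refine (h0.comp_measurePreserving hmp).congr (Filter.Eventually.of_forall fun x => ?_)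
  have := hf.1.sub_zsmul_eq (x := x) n
  simpa using this

lemma intervalIntegrable (hp : 1 ≤ p) (hf : IsLp p f) (a b : ℝ) :
    IntervalIntegrable f volume a b := by
  refine hf.1.intervalIntegrable₀ one_ne_zero ?_ a b
  rw [intervalIntegrable_iff_integrableOn_Ico_of_le zero_le_one]
  exact hf.2.integrable (one_le_ofReal hp)

lemma comp_add_right (hp : 1 ≤ p) (hf : IsLp p f) (t : ℝ) : IsLp p (fun x => f (x + t)) := by
  refine ⟨fun x => by simp only; rw [add_right_comm, hf.1], ?_, ?_⟩
  · exact (hf.aestronglyMeasurable.comp_measurePreserving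
      (measurePreserving_add_right volume t)).restrict
  · exact (normLp_comp_add_right hp hf.1 t).trans_lt hf.2.2

lemma sub (hf : IsLp p f) (hg : IsLp p g) : IsLp p (f - g) :=
  ⟨fun x => by simp [hf.1 x, hg.1 x], hf.2.sub hg.2⟩

lemma const_smul (hf : IsLp p f) (c : ℝ) : IsLp p (fun x => c • f x) :=
  ⟨fun x => by simp [hf.1 x], hf.2.const_smul c⟩

lemma sum {ι : Type*} (S : Finset ι) {F : ι → ℝ → 𝕜} (hF : ∀ i ∈ S, IsLp p (F i)) :
    IsLp p (fun x => ∑ i ∈ S, F i x) :=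
  ⟨fun x => Finset.sum_congr rfl fun i hi => (hF i hi).1 x,
    memLp_finsetSum S fun i hi => (hF i hi).2⟩

lemma of_continuous (hf : Continuous f) (hper : Function.Periodic f 1) : IsLp p f := by
  refine ⟨hper, ?_⟩
  obtain ⟨C, hC⟩ := (isCompact_Icc (a := (0 : ℝ)) (b := 1)).exists_bound_of_continuousOn
    hf.continuousOn
  refine MemLp.of_bound hf.aestronglyMeasurable C ?_
  filter_upwards [ae_restrict_mem measurableSet_Ico] with x hx
  exact hC x ⟨hx.1, hx.2.le⟩

end IsLp

lemma normLp_add_le {p : ℝ} (hp : 1 ≤ p) {f g : ℝ → 𝕜} (hf : IsLp p f) (hg : IsLp p g) :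
    normLp p (f + g) ≤ normLp p f + normLp p g :=
  eLpNorm_add_le hf.2.1 hg.2.1 (one_le_ofReal hp)

lemma normLp_const_smul (p : ℝ) (c : ℝ) (f : ℝ → 𝕜) :
    normLp p (fun x => c • f x) = ‖c‖ₑ * normLp p f :=
  eLpNorm_const_smul c f _ _

lemma normLp_sum_le {p : ℝ} (hp : 1 ≤ p) {ι : Type*} (S : Finset ι) {F : ι → ℝ → 𝕜}
    (hF : ∀ i ∈ S, IsLp p (F i)) :
    normLp p (fun x => ∑ i ∈ S, F i x) ≤ ∑ i ∈ S, normLp p (F i) := by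
  have := eLpNorm_sum_le (s := S) (f := F) (fun i hi => (hF i hi).2.1) (one_le_ofReal hp)
  refine le_trans (le_of_eq ?_) this
  rw [normLp]
  congr 1
  ext x
  simp

/-! ### Averages -/

/-- Jensen's inequality for the `p`-th power, in the form of Hölder's inequality against the
constant function `1`. -/
lemma lintegral_rpow_le {α : Type*} [MeasurableSpace α] {μ : Measure α} {p : ℝ} (hp : 1 ≤ p)
    {Φ : α → ℝ≥0∞} (hΦ : AEMeasurable Φ μ) :
    (∫⁻ x, Φ x ∂μ) ^ p ≤ μ Set.univ ^ (p - 1) * ∫⁻ x, Φ x ^ p ∂μ := by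
  have h := eLpNorm_le_eLpNorm_mul_rpow_measure_univ (one_le_ofReal hp)
    hΦ.aestronglyMeasurable
  rw [eLpNorm_one_eq_lintegral_enorm,
    eLpNorm_eq_lintegral_rpow_enorm_toReal (ofReal_ne_zero_of_one_le hp)
    ENNReal.ofReal_ne_top, ENNReal.toReal_ofReal (by linarith)] at h
  simp only [enorm_eq_self, ENNReal.toReal_one] at h
  have h2 := ENNReal.rpow_le_rpow h (show 0 ≤ p by linarith)
  rw [ENNReal.mul_rpow_of_nonneg _ _ (by linarith), ← ENNReal.rpow_mul, ← ENNReal.rpow_mul,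
    one_div_mul_cancel (by linarith), ENNReal.rpow_one, mul_comm] at h2
  convert h2 using 3
  field_simp

/-- Minkowski's inequality for an average over a parameter in a unit interval. -/
lemma lintegral_average_rpow_le {p : ℝ} (hp : 1 ≤ p) {μ : Measure ℝ} [SFinite μ]
    {Φ : ℝ → ℝ → ℝ≥0∞}
    (hΦ : AEMeasurable (Function.uncurry Φ) (μ.prod (volume.restrict (Set.Ioc (0 : ℝ) 1))))
    {M : ℝ≥0∞} (hM : ∀ t ∈ Set.Ioc (0 : ℝ) 1, ∫⁻ x, Φ x t ^ p ∂μ ≤ M) :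
    ∫⁻ x, (∫⁻ t in Set.Ioc (0 : ℝ) 1, Φ x t) ^ p ∂μ ≤ M := by
  calc ∫⁻ x, (∫⁻ t in Set.Ioc (0 : ℝ) 1, Φ x t) ^ p ∂μ
      ≤ ∫⁻ x, (∫⁻ t in Set.Ioc (0 : ℝ) 1, Φ x t ^ p) ∂μ := by
        refine lintegral_mono_ae ?_
        filter_upwards [hΦ.aestronglyMeasurable.prodMk_left] with x hx
        simpa using lintegral_rpow_le hp hx.aemeasurable
    _ = ∫⁻ t in Set.Ioc (0 : ℝ) 1, (∫⁻ x, Φ x t ^ p ∂μ) :=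
        lintegral_lintegral_swap (hΦ.pow_const p)
    _ ≤ ∫⁻ _ in Set.Ioc (0 : ℝ) 1, M := setLIntegral_mono' measurableSet_Ioc hM
    _ = M := by simp

/-- The map `(x, t) ↦ x + d t` pulls null sets back to null sets, so that a function defined up
to a null set may be composed with it. -/
lemma quasiMeasurePreserving_add_mul (d : ℝ) (I J : Set ℝ) :
    Measure.QuasiMeasurePreserving (fun z : ℝ × ℝ => z.1 + d * z.2)
      ((volume.restrict I).prod (volume.restrict J)) volume := by
  refine QuasiMeasurePreserving.prod_of_left (by fun_prop)
    (Filter.Eventually.of_forall fun t => ?_)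
  refine ((measurePreserving_add_right volume (d * t)).quasiMeasurePreserving).mono ?_
    Measure.AbsolutelyContinuous.rfl
  exact Measure.absolutelyContinuous_of_le Measure.restrict_le_self

/-! ### Finite differences -/

lemma diff_eq_fwdDiff (s : ℕ) (h : ℝ) (f : ℝ → 𝕜) : diff s h f = (fwdDiff h)^[s] f := by
  ext x
  rw [fwdDiff_iter_eq_sum_shift, diff, ← Finset.sum_range_reflect]
  refine Finset.sum_congr rfl fun k hk => ?_
  have hk' : k ≤ s := by simpa [Nat.lt_succ_iff] using hk
  have h1 : s + 1 - 1 - k = s - k := by omega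
  rw [h1, Nat.choose_symm hk', ← Int.cast_smul_eq_zsmul ℝ]
  push_cast [Nat.cast_sub hk']
  congr 2
  simp

lemma diff_zero (h : ℝ) (f : ℝ → 𝕜) : diff 0 h f = f := by
  simp [diff_eq_fwdDiff]

lemma diff_succ (s : ℕ) (h : ℝ) (f : ℝ → 𝕜) (x : ℝ) :
    diff (s + 1) h f x = diff s h f (x + h) - diff s h f x := by
  simp only [diff_eq_fwdDiff, Function.iterate_succ_apply', fwdDiff]

lemma diff_succ' (s : ℕ) (h : ℝ) (f : ℝ → 𝕜) :
    diff (s + 1) h f = diff s h (fun x => f (x + h) - f x) := by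
  simp only [diff_eq_fwdDiff, Function.iterate_succ_apply]
  rfl

lemma diff_add (a b : ℕ) (h : ℝ) (f : ℝ → 𝕜) : diff (a + b) h f = diff a h (diff b h f) := by
  simp only [diff_eq_fwdDiff, Function.iterate_add_apply]

lemma diff_sub (s : ℕ) (h : ℝ) (f g : ℝ → 𝕜) : diff s h (f - g) = diff s h f - diff s h g := by
  ext x
  simp [diff, smul_sub, Finset.sum_sub_distrib]

lemma diff_step_zero {s : ℕ} (hs : 1 ≤ s) (f : ℝ → 𝕜) (x : ℝ) : diff s 0 f x = 0 := by
  obtain ⟨m, rfl⟩ := Nat.exists_eq_add_of_le' hs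
  rw [diff_succ, add_zero, sub_self]

lemma enorm_diff_le (s : ℕ) (h : ℝ) (f : ℝ → 𝕜) (x : ℝ) {M : ℝ≥0∞}
    (hM : ∀ k ≤ s, ‖f (x + k * h)‖ₑ ≤ M) : ‖diff s h f x‖ₑ ≤ 2 ^ s * M := by
  induction s generalizing x with
  | zero => simpa [diff_zero] using hM 0 le_rfl
  | succ s ih =>
    rw [diff_succ]
    refine (enorm_sub_le).trans ?_
    have h1 := ih (x + h) fun k hk => by
      have := hM (k + 1) (by omega)
      convert this using 3
      push_cast; ring
    have h2 := ih x fun k hk => hM k (by omega)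
    calc _ ≤ 2 ^ s * M + 2 ^ s * M := add_le_add h1 h2
      _ = _ := by ring

lemma IsLp.diff {p : ℝ} (hp : 1 ≤ p) {f : ℝ → 𝕜} (hf : IsLp p f) (s : ℕ) (h : ℝ) :
    IsLp p (diff s h f) :=
  IsLp.sum _ fun _ _ => (hf.comp_add_right hp _).const_smul _

lemma normLp_diff_le {p : ℝ} (hp : 1 ≤ p) {f : ℝ → 𝕜} (hf : IsLp p f) (s : ℕ) (h : ℝ) :
    normLp p (diff s h f) ≤ 2 ^ s * normLp p f := by
  induction s with
  | zero => simp [diff_zero]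
  | succ s ih =>
    have hd := hf.diff hp s h
    have h0 : diff (s + 1) h f = (fun x => diff s h f (x + h)) - diff s h f := by
      ext x; exact diff_succ s h f x
    rw [h0]
    refine (eLpNorm_sub_le (hd.comp_add_right hp h).2.1 hd.2.1 (one_le_ofReal hp)).trans ?_
    have h1 := normLp_comp_add_right hp hd.1 h
    change normLp p (fun x => diff s h f (x + h)) + normLp p (diff s h f) ≤ _
    rw [h1]
    calc normLp p (diff s h f) + normLp p (diff s h f)
      ≤ 2 ^ s * normLp p f + 2 ^ s * normLp p f := add_le_add ih ih
      _ = _ := by ring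

lemma iteratedDeriv_comp_add_sub {m : ℕ} {F : ℝ → 𝕜} (hF : ContDiff ℝ m F) (u : ℝ) :
    iteratedDeriv m (fun x => F (x + u) - F x) =
      fun x => iteratedDeriv m F (x + u) - iteratedDeriv m F x := by
  ext x
  have h := iteratedDeriv_fun_sub (n := m) (x := x) (f := fun x => F (x + u)) (g := F)
    (hF.comp (contDiff_id.add contDiff_const)).contDiffAt hF.contDiffAt
  rw [h, iteratedDeriv_comp_add_const]

/-- Intermediate points of a stencil lie in every convex set containing its end points. -/
lemma add_mul_mem_of_convex {I : Set ℝ} (hI : Convex ℝ I) {y u K k : ℝ} (hy : y ∈ I)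
    (hy' : y + K * u ∈ I) (hk : 0 ≤ k) (hkK : k ≤ K) : y + k * u ∈ I := by
  rcases (hk.trans hkK).eq_or_lt with hK | hK
  · have : k = 0 := by linarith
    simpa [this] using hy
  · have := hI.add_smul_sub_mem hy hy' (t := k / K) ⟨by positivity, (div_le_one hK).mpr hkK⟩
    convert this using 1
    simp only [smul_eq_mul]
    field_simp
    ring

/-- The mean value inequality for differences of order `m`: along a convex set containing both
ends of the stencil, the difference is bounded by the `m`-th derivative. -/
lemma norm_diff_le_of_contDiff (m : ℕ) {F : ℝ → 𝕜} (hF : ContDiff ℝ m F) {u M : ℝ} {I : Set ℝ}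
    (hI : Convex ℝ I) (hM : ∀ z ∈ I, ‖iteratedDeriv m F z‖ ≤ M) {y : ℝ} (hy : y ∈ I)
    (hy' : y + m * u ∈ I) : ‖diff m u F y‖ ≤ |u| ^ m * M := by
  induction m generalizing F M I y with
  | zero => simpa [diff_zero] using hM y hy
  | succ m ih =>
    have hFm : ContDiff ℝ m F := hF.of_le (by exact_mod_cast Nat.le_succ m)
    have hd : ContDiff ℝ m (fun x => F (x + u) - F x) :=
      (hFm.comp (contDiff_id.add contDiff_const)).sub hFm
    have hI' : Convex ℝ (I ∩ (fun x => x + u) ⁻¹' I) :=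
      hI.inter (hI.translate_preimage_left u)
    have hmem : ∀ k : ℝ, 0 ≤ k → k ≤ m + 1 → y + k * u ∈ I := fun k hk hk' =>
      add_mul_mem_of_convex hI hy hy' hk (by push_cast; exact hk')
    have hbound : ∀ z ∈ I ∩ (fun x => x + u) ⁻¹' I,
        ‖iteratedDeriv m (fun x => F (x + u) - F x) z‖ ≤ |u| * M := by
      rintro z ⟨hz, hz'⟩
      rw [iteratedDeriv_comp_add_sub hFm]
      have hdiff : Differentiable ℝ (iteratedDeriv m F) :=
        hF.differentiable_iteratedDeriv m (by exact_mod_cast Nat.lt_succ_self m)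
      have := hI.norm_image_sub_le_of_norm_deriv_le (f := iteratedDeriv m F) (C := M)
        (fun x _ => hdiff x) (fun x hx => by
          rw [← iteratedDeriv_succ]; exact hM x hx) hz hz'
      simpa [mul_comm] using this
    rw [diff_succ', pow_succ, mul_assoc]
    refine ih hd hI' hbound ⟨hy, ?_⟩ ⟨hmem m (by positivity) (by linarith), ?_⟩
    · have := hmem 1 zero_le_one (by linarith [(Nat.cast_nonneg m : (0 : ℝ) ≤ m)])
      simpa using this
    · simp only [Set.mem_preimage]
      have := hmem (m + 1) (by positivity) le_rfl
      convert this using 1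
      ring

/-! ### Sobolev functions -/

/-- The fundamental theorem of calculus for absolutely continuous functions with values in `ℝ` or
`ℂ`. -/
lemma integral_deriv_eq_sub_of_absolutelyContinuous {F : ℝ → 𝕜} {a b : ℝ}
    (hF : AbsolutelyContinuousOnInterval F a b) (hint : IntervalIntegrable (deriv F) volume a b) :
    ∫ x in a..b, deriv F x = F b - F a := by
  have hL : ∀ L : 𝕜 →L[ℝ] ℝ, AbsolutelyContinuousOnInterval (fun x => L (F x)) a b := by
    intro L
    refine squeeze_zero (fun E => Finset.sum_nonneg fun i _ => dist_nonneg) (fun E => ?_)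
      (by simpa using Filter.Tendsto.const_mul ‖L‖ hF)
    rw [Finset.mul_sum]
    exact Finset.sum_le_sum fun i _ => L.lipschitz.dist_le_mul _ _
  have hre := hL RCLike.reCLM
  have him := hL RCLike.imCLM
  have hdiff : ∀ᵐ x : ℝ, x ∈ Set.uIcc a b → DifferentiableAt ℝ F x := by
    filter_upwards [hre.ae_differentiableAt, him.ae_differentiableAt] with x h1 h2 hx
    have h3 := ((RCLike.ofRealCLM (K := 𝕜)).differentiableAt.comp x (h1 hx)).add
      (((RCLike.ofRealCLM (K := 𝕜)).differentiableAt.comp x (h2 hx)).mul_const (RCLike.I : 𝕜))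
    refine h3.congr_of_eventuallyEq (Filter.Eventually.of_forall fun y => ?_)
    simp [RCLike.re_add_im]
  have key : ∀ L : 𝕜 →L[ℝ] ℝ, L (F b - F a) = L (∫ x in a..b, deriv F x) := by
    intro L
    rw [map_sub, ← (hL L).integral_deriv_eq_sub, ← L.intervalIntegral_comp_comm hint]
    refine intervalIntegral.integral_congr_ae ?_
    filter_upwards [hdiff] with x hx hx'
    exact (L.hasFDerivAt.comp_hasDerivAt x
      (hx (Set.uIoc_subset_uIcc hx')).hasDerivAt).deriv
  exact (RCLike.ext (key RCLike.reCLM) (key RCLike.imCLM)).symm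

/-- A difference of order `s` of a function in `W_p^s` is controlled by the integral of its `s`-th
derivative over any interval containing the stencil. -/
lemma enorm_diff_le_of_isSobolev {p : ℝ} (hp : 1 ≤ p) {s : ℕ} (hs : 1 ≤ s) {g : ℝ → 𝕜}
    (hg : IsSobolev p s g) {a b u y : ℝ} (hab : a ≤ b) (hy : y ∈ Set.Icc a b)
    (hy' : y + s * u ∈ Set.Icc a b) :
    ‖diff s u g y‖ₑ ≤ ‖u‖ₑ ^ (s - 1) * ∫⁻ t in Set.Ioc a b, ‖iteratedDeriv s g t‖ₑ := by
  obtain ⟨m, rfl⟩ := Nat.exists_eq_add_of_le' hs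
  obtain ⟨-, hC, hAC, hLp⟩ := hg
  simp only [Nat.add_sub_cancel] at hC hAC ⊢
  set G := iteratedDeriv (m + 1) g with hG
  have hder : deriv (iteratedDeriv m g) = G := by rw [hG, iteratedDeriv_succ]
  have hint := hLp.intervalIntegrable hp
  have hintab : IntegrableOn G (Set.Ioc a b) :=
    (intervalIntegrable_iff_integrableOn_Ioc_of_le hab).mp (hint a b)
  set M := ∫ t in Set.Ioc a b, ‖G t‖
  have hMe : ∫⁻ t in Set.Ioc a b, ‖G t‖ₑ = ENNReal.ofReal M :=
    (ofReal_integral_norm_eq_lintegral_enorm hintab).symm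
  have hbound : ∀ z ∈ Set.Icc a b ∩ (fun x => x + u) ⁻¹' Set.Icc a b,
      ‖iteratedDeriv m (fun x => g (x + u) - g x) z‖ ≤ M := by
    rintro z ⟨hz, hz'⟩
    rw [iteratedDeriv_comp_add_sub hC]
    change ‖iteratedDeriv m g (z + u) - iteratedDeriv m g z‖ ≤ M
    rw [← integral_deriv_eq_sub_of_absolutelyContinuous (hAC _ _)
      (by rw [hder]; exact hint _ _), hder]
    refine intervalIntegral.norm_integral_le_integral_norm_uIoc.trans ?_
    refine setIntegral_mono_set hintab.norm (Filter.Eventually.of_forall fun _ => norm_nonneg _)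
      (LE.le.eventuallyLE ?_)
    have hz' : z + u ∈ Set.Icc a b := hz'
    exact Set.Ioc_subset_Ioc (le_min hz.1 hz'.1) (max_le hz.2 hz'.2)
  have hmem : ∀ k : ℝ, 0 ≤ k → k ≤ m + 1 → y + k * u ∈ Set.Icc a b := fun k hk hk' =>
    add_mul_mem_of_convex (convex_Icc a b) hy hy' hk (by push_cast; exact hk')
  have hm0 : (0 : ℝ) ≤ m := Nat.cast_nonneg m
  have key := norm_diff_le_of_contDiff m
    ((hC.comp (contDiff_id.add contDiff_const)).sub hC : ContDiff ℝ m fun x => g (x + u) - g x)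
    ((convex_Icc a b).inter ((convex_Icc a b).translate_preimage_left u)) hbound (y := y)
    ⟨hy, by simpa only [one_mul, Set.mem_preimage] using hmem 1 zero_le_one (by linarith)⟩
    ⟨hmem m hm0 (by linarith), by
      have := hmem (m + 1) (by positivity) le_rfl
      rw [Set.mem_preimage]
      convert this using 1
      ring⟩
  rw [hMe, diff_succ', ← ofReal_norm, ← ofReal_norm, ← ENNReal.ofReal_pow (norm_nonneg _),
    ← ENNReal.ofReal_mul (by positivity)]
  exact ENNReal.ofReal_le_ofReal key

lemma setLIntegral_Ioc_eq_mul {c : ℝ} (hc : 0 < c) (a : ℝ) (Φ : ℝ → ℝ≥0∞) :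
    ∫⁻ y in Set.Ioc a (a + c), Φ y =
      ENNReal.ofReal c * ∫⁻ t in Set.Ioc (0 : ℝ) 1, Φ (a + c * t) := by
  have h := (MeasurableEquiv.addLeft a).measurableEmbedding.comp
    (MeasurableEquiv.mulLeft₀ c hc.ne').measurableEmbedding
  have hmap : Measure.map (fun t : ℝ => a + c * t) volume = ENNReal.ofReal c⁻¹ • volume := by
    have h1 := Real.map_volume_mul_left hc.ne'
    rw [abs_of_pos (by positivity)] at h1
    have h2 : (fun t : ℝ => a + c * t) = (fun x => a + x) ∘ (fun t => c * t) := rfl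
    rw [h2, ← Measure.map_map (by fun_prop) (by fun_prop), h1, Measure.map_smul,
      (measurePreserving_add_left volume a).map_eq]
  have h' : MeasurableEmbedding fun t : ℝ => a + c * t := h
  have h3 := h'.lintegral_map (μ := volume.restrict ((fun t : ℝ => a + c * t) ⁻¹'
    Set.Ioc a (a + c))) Φ
  rw [← h'.restrict_map] at h3
  have h4 : (fun t : ℝ => a + c * t) ⁻¹' Set.Ioc a (a + c) = Set.Ioc 0 1 := by
    ext t
    simp only [Set.mem_preimage, Set.mem_Ioc]
    constructor
    · rintro ⟨h1, h2⟩
      exact ⟨by by_contra hn; nlinarith, by by_contra hn; nlinarith⟩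
    · rintro ⟨h1, h2⟩
      exact ⟨by nlinarith, by nlinarith⟩
  rw [hmap, h4, Measure.restrict_smul, lintegral_smul_measure] at h3
  rw [← h3, smul_eq_mul, ← mul_assoc, ← ENNReal.ofReal_mul hc.le, mul_inv_cancel₀ hc.ne']
  simp

/-- The classical estimate `‖Δ_h^s g‖_p ≤ s h ^ s ‖g^{(s)}‖_p`: the pointwise bound by an integral
over the stencil is an average of translates of `|g^{(s)}|`. -/
lemma normLp_diff_le_of_isSobolev {p : ℝ} (hp : 1 ≤ p) {s : ℕ} (hs : 1 ≤ s) {g : ℝ → 𝕜}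
    (hg : IsSobolev p s g) {h : ℝ} (hh : 0 < h) :
    normLp p (diff s h g) ≤ s * ENNReal.ofReal h ^ s * normLp p (iteratedDeriv s g) := by
  set G := iteratedDeriv s g
  have hLp : IsLp p G := hg.2.2.2
  have hsh : 0 < (s : ℝ) * h := by positivity
  have hpt : ∀ x, ‖diff s h g x‖ₑ ≤ s * ENNReal.ofReal h ^ s *
      ∫⁻ t in Set.Ioc (0 : ℝ) 1, ‖G (x + s * h * t)‖ₑ := by
    intro x
    refine (enorm_diff_le_of_isSobolev hp hs hg (a := x) (b := x + s * h) (by linarith)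
      ⟨le_rfl, by linarith⟩ ⟨by linarith, le_rfl⟩).trans (le_of_eq ?_)
    rw [setLIntegral_Ioc_eq_mul hsh, Real.enorm_of_nonneg hh.le,
      ENNReal.ofReal_mul (Nat.cast_nonneg s), ENNReal.ofReal_natCast]
    obtain ⟨m, rfl⟩ := Nat.exists_eq_add_of_le' hs
    simp only [Nat.add_sub_cancel, pow_succ]
    ring
  have hp0 : 0 ≤ p := by linarith
  rw [normLp_le_iff hp, ENNReal.mul_rpow_of_nonneg _ _ hp0]
  calc ∫⁻ x in Set.Ico (0 : ℝ) 1, ‖diff s h g x‖ₑ ^ p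
      ≤ ∫⁻ x in Set.Ico (0 : ℝ) 1, (s * ENNReal.ofReal h ^ s) ^ p *
        (∫⁻ t in Set.Ioc (0 : ℝ) 1, ‖G (x + s * h * t)‖ₑ) ^ p := by
        refine lintegral_mono fun x => ?_
        rw [← ENNReal.mul_rpow_of_nonneg _ _ hp0]
        exact ENNReal.rpow_le_rpow (hpt x) hp0
    _ = (s * ENNReal.ofReal h ^ s) ^ p * ∫⁻ x in Set.Ico (0 : ℝ) 1,
        (∫⁻ t in Set.Ioc (0 : ℝ) 1, ‖G (x + s * h * t)‖ₑ) ^ p := by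
        refine lintegral_const_mul' _ _ (ENNReal.rpow_ne_top_of_nonneg hp0 ?_)
        exact ENNReal.mul_ne_top (by simp) (by simp)
    _ ≤ _ := by
        gcongr
        refine lintegral_average_rpow_le hp ?_ fun t _ => ?_
        · exact (hLp.aestronglyMeasurable.comp_quasiMeasurePreserving
            (quasiMeasurePreserving_add_mul _ _ _)).enorm
        · rw [← normLp_rpow hp, normLp_comp_add_right hp hLp.1]

/-! ### Discrete norms over separated nodes -/

lemma normDiscrete_add_le {p : ℝ} (hp : 1 ≤ p) {n : ℕ} (x : Fin n → ℝ) (f g : ℝ → 𝕜) :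
    normDiscrete p x (f + g) ≤ normDiscrete p x f + normDiscrete p x g := by
  have hp0 : 0 ≤ 1 / p := by positivity
  have hsplit : ∀ F : ℝ → 𝕜, normDiscrete p x F =
      ((n : ℝ≥0∞)⁻¹) ^ (1 / p) * (∑ k : Fin n, ‖F (x k)‖ₑ ^ p) ^ (1 / p) := fun F => by
    rw [normDiscrete, ENNReal.mul_rpow_of_nonneg _ _ hp0]
  rw [hsplit, hsplit, hsplit, ← mul_add]
  gcongr
  refine le_trans ?_ (ENNReal.Lp_add_le Finset.univ (fun k => ‖f (x k)‖ₑ)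
    (fun k => ‖g (x k)‖ₑ) hp)
  gcongr
  exact enorm_add_le _ _

lemma normDiscrete_congr_enorm {p : ℝ} {n : ℕ} (x : Fin n → ℝ) {f g : ℝ → 𝕜}
    (h : ∀ y, ‖f y‖ₑ = ‖g y‖ₑ) : normDiscrete p x f = normDiscrete p x g := by
  simp only [normDiscrete, h]

namespace IsNodeSystem

variable {γ : ℝ} {X : (n : ℕ) → Fin n → ℝ}

lemma le_sub_of_lt (hX : IsNodeSystem γ X) {n : ℕ} {i j : Fin n} (hij : i < j) :
    γ / n ≤ X n j - X n i := by
  obtain ⟨hmono, -, hsep⟩ := hX n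
  have h := hsep i
  have hlt : (i : ℕ) + 1 < n := lt_of_le_of_lt hij j.isLt
  rw [nextNode, dif_pos hlt] at h
  have hle : X n ⟨(i : ℕ) + 1, hlt⟩ ≤ X n j := hmono.monotone (by
    rw [Fin.le_iff_val_le_val]; exact hij)
  linarith

/-- The separation of two nodes across the end of the period. -/
lemma le_one_add_sub (hX : IsNodeSystem γ X) {n : ℕ} (i j : Fin n) :
    γ / n ≤ 1 + X n i - X n j := by
  obtain ⟨hmono, -, hsep⟩ := hX n
  have hn : 0 < n := lt_of_le_of_lt (Nat.zero_le _) i.isLt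
  have h := hsep ⟨n - 1, by omega⟩
  rw [nextNode, dif_neg (by simp only; omega)] at h
  have h1 : X n j ≤ X n ⟨n - 1, by omega⟩ := hmono.monotone (by
    rw [Fin.le_iff_val_le_val]; have := j.isLt; simp only; omega)
  have h2 : X n ⟨0, hn⟩ ≤ X n i := hmono.monotone (by
    rw [Fin.le_iff_val_le_val]; exact Nat.zero_le _)
  linarith

/-- The windows of width `γ / n` centred at the nodes are disjoint and fit into one period. -/
lemma sum_window_le (hX : IsNodeSystem γ X) {n : ℕ} (hn : 1 ≤ n) {Φ : ℝ → ℝ≥0∞}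
    (hΦ : Function.Periodic Φ 1) :
    ∑ k : Fin n, ∫⁻ t in Set.Ioc (X n k - γ / n / 2) (X n k + γ / n / 2), Φ t ≤
      ∫⁻ t in Set.Ico (0 : ℝ) 1, Φ t := by
  set a := X n ⟨0, hn⟩ - γ / n / 2 with ha
  rw [← setLIntegral_Ioc_of_periodic hΦ a, ← tsum_fintype (L := .unconditional _),
    ← lintegral_iUnion (fun _ => measurableSet_Ioc)]
  · refine lintegral_mono_set (Set.iUnion_subset fun k => ?_)
    have h1 := hX.le_one_add_sub ⟨0, hn⟩ k
    have h2 : X n ⟨0, hn⟩ ≤ X n k := (hX n).1.monotone (by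
      rw [Fin.le_iff_val_le_val]; exact Nat.zero_le _)
    exact Set.Ioc_subset_Ioc (by linarith) (by linarith)
  · have key : ∀ i j : Fin n, i < j →
        Disjoint (Set.Ioc (X n i - γ / n / 2) (X n i + γ / n / 2))
          (Set.Ioc (X n j - γ / n / 2) (X n j + γ / n / 2)) := by
      intro i j hij
      have h := hX.le_sub_of_lt hij
      refine Set.disjoint_left.mpr fun y hy hy' => ?_
      linarith [hy.2, hy'.1]
    intro i j hij
    rcases lt_or_gt_of_ne hij with h | h
    · exact key i j h
    · exact (key j i h).symm

/-- A function dominated at the nodes by the means of `G` over windows of width `γ / n` has its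
discrete norm controlled by the integral norm of `G`. -/
lemma normDiscrete_le {p : ℝ} (hp : 1 ≤ p) (hγ : γ ∈ Set.Ioc (0 : ℝ) 1) (hX : IsNodeSystem γ X)
    {n : ℕ} (hn : 1 ≤ n) {v G : ℝ → 𝕜} (hG : IsLp p G) {K : ℝ≥0∞}
    (hv : ∀ k, ‖v (X n k)‖ₑ ≤ K * ((ENNReal.ofReal (γ / n))⁻¹ *
      ∫⁻ t in Set.Ioc (X n k - γ / n / 2) (X n k + γ / n / 2), ‖G t‖ₑ)) :
    normDiscrete p (X n) v ≤ K * ENNReal.ofReal γ⁻¹ * normLp p G := by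
  have hp0 : 0 < p := by linarith
  have hn0 : (0 : ℝ) < n := by exact_mod_cast hn
  have hδ : 0 < γ / n := div_pos hγ.1 hn0
  set d := ENNReal.ofReal (γ / n) with hd
  have hd0 : d ≠ 0 := by simpa [hd] using hδ
  have hdt : d ≠ ⊤ := ENNReal.ofReal_ne_top
  have hpt : ∀ k, ‖v (X n k)‖ₑ ^ p ≤ K ^ p * (d⁻¹ *
      ∫⁻ t in Set.Ioc (X n k - γ / n / 2) (X n k + γ / n / 2), ‖G t‖ₑ ^ p) := by
    intro k
    refine (ENNReal.rpow_le_rpow (hv k) hp0.le).trans ?_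
    rw [ENNReal.mul_rpow_of_nonneg _ _ hp0.le, ENNReal.mul_rpow_of_nonneg _ _ hp0.le]
    refine mul_le_mul_right ?_ _
    have h := lintegral_rpow_le hp (hG.aestronglyMeasurable.restrict (s := Set.Ioc
      (X n k - γ / n / 2) (X n k + γ / n / 2))).enorm
    have hvol : volume (Set.Ioc (X n k - γ / n / 2) (X n k + γ / n / 2)) = d := by
      rw [Real.volume_Ioc, hd]; congr 1; ring
    rw [Measure.restrict_apply_univ, hvol] at h
    refine (mul_le_mul_right h _).trans (le_of_eq ?_)
    rw [← mul_assoc, ENNReal.rpow_sub _ _ hd0 hdt, ENNReal.rpow_one, ENNReal.inv_rpow,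
      ENNReal.div_eq_inv_mul, ← mul_assoc, mul_comm (d ^ p)⁻¹, mul_assoc d⁻¹,
      ENNReal.inv_mul_cancel (by simp [hd0, hdt]) (by simp [hd0, hdt]), mul_one]
  have hsum : (n : ℝ≥0∞)⁻¹ * ∑ k : Fin n, ‖v (X n k)‖ₑ ^ p ≤
      K ^ p * (ENNReal.ofReal γ⁻¹ * normLp p G ^ p) := by
    have hnd : (n : ℝ≥0∞)⁻¹ * d⁻¹ = ENNReal.ofReal γ⁻¹ := by
      rw [hd, ← ENNReal.ofReal_natCast, ← ENNReal.ofReal_inv_of_pos hn0,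
        ← ENNReal.ofReal_inv_of_pos hδ, ← ENNReal.ofReal_mul (by positivity)]
      congr 1
      have := hγ.1.ne'
      field_simp
    calc (n : ℝ≥0∞)⁻¹ * ∑ k : Fin n, ‖v (X n k)‖ₑ ^ p
        ≤ (n : ℝ≥0∞)⁻¹ * ∑ k : Fin n, K ^ p * (d⁻¹ *
          ∫⁻ t in Set.Ioc (X n k - γ / n / 2) (X n k + γ / n / 2), ‖G t‖ₑ ^ p) := by
          gcongr with k; exact hpt k
      _ = K ^ p * (ENNReal.ofReal γ⁻¹ * ∑ k : Fin n,
          ∫⁻ t in Set.Ioc (X n k - γ / n / 2) (X n k + γ / n / 2), ‖G t‖ₑ ^ p) := by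
          rw [← Finset.mul_sum, ← Finset.mul_sum, ← hnd]; ring
      _ ≤ _ := by
          rw [normLp_rpow hp]
          gcongr
          exact hX.sum_window_le hn fun t => by simp only [hG.1 t]
  have hγ1 : 1 ≤ ENNReal.ofReal γ⁻¹ := by
    simpa using (one_le_inv₀ hγ.1).mpr hγ.2
  calc normDiscrete p (X n) v
      ≤ (K ^ p * (ENNReal.ofReal γ⁻¹ * normLp p G ^ p)) ^ (1 / p) :=
        ENNReal.rpow_le_rpow hsum (by positivity)
    _ ≤ (K ^ p * (ENNReal.ofReal γ⁻¹ ^ p * normLp p G ^ p)) ^ (1 / p) := by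
        gcongr
        nth_rewrite 1 [← ENNReal.rpow_one (ENNReal.ofReal γ⁻¹)]
        exact ENNReal.rpow_le_rpow_of_exponent_le hγ1 hp
    _ = K * ENNReal.ofReal γ⁻¹ * normLp p G := by
        rw [← ENNReal.mul_rpow_of_nonneg _ _ hp0.le, ← ENNReal.mul_rpow_of_nonneg _ _ hp0.le,
          ← ENNReal.rpow_mul, mul_one_div_cancel hp0.ne', ENNReal.rpow_one, mul_assoc]

end IsNodeSystem

/-! ### Generalized Steklov averages -/

lemma intervalIntegrable_comp_add_mul {f : ℝ → 𝕜} (hf : ∀ a b, IntervalIntegrable f volume a b)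
    (x c a b : ℝ) : IntervalIntegrable (fun t => f (x + c * t)) volume a b := by
  rcases eq_or_ne c 0 with rfl | hc
  · simp
  · have h1 : IntervalIntegrable (fun t => f (x + t)) volume (c * a) (c * b) := by
      have := (hf (c * a + x) (c * b + x)).comp_add_left x
      simpa using this
    have := h1.comp_mul_left (c := c)
    simpa [hc] using this

lemma intervalIntegrable_smul_comp_add_mul {f : ℝ → 𝕜}
    (hf : ∀ a b, IntervalIntegrable f volume a b) (m x c a b : ℝ) :
    IntervalIntegrable (fun t => m • f (x + c * t)) volume a b :=
  (intervalIntegrable_comp_add_mul hf x c a b).smul m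

lemma steklov_eq {f : ℝ → 𝕜} (hf : ∀ a b, IntervalIntegrable f volume a b) (δ : ℝ) (r : ℕ)
    (x : ℝ) : steklov δ r f x =
      ((-1 : ℝ) ^ (r + 1) * ((2 * r).choose r : ℝ)⁻¹ * (2 / δ)) • ∑ ν ∈ Finset.range r,
        ((-1 : ℝ) ^ ν * ((2 * r).choose ν : ℝ)) •
          ∫ t in (-(δ / 2))..(δ / 2), f (x + ((r : ℝ) - ν) / r * t) := by
  rw [steklov, intervalIntegral.integral_finsetSum]
  · simp only [intervalIntegral.integral_smul]
  · exact fun ν _ => intervalIntegrable_smul_comp_add_mul hf _ _ _ _ _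

lemma steklov_sub {f g : ℝ → 𝕜} (hf : ∀ a b, IntervalIntegrable f volume a b)
    (hg : ∀ a b, IntervalIntegrable g volume a b) (δ : ℝ) (r : ℕ) :
    steklov δ r (f - g) = steklov δ r f - steklov δ r g := by
  ext x
  rw [Pi.sub_apply, steklov_eq hf, steklov_eq hg,
    steklov_eq (f := f - g) (fun a b => (hf a b).sub (hg a b)),
    ← smul_sub, ← Finset.sum_sub_distrib]
  congr 1
  refine Finset.sum_congr rfl fun ν _ => ?_
  rw [← smul_sub, ← intervalIntegral.integral_sub (intervalIntegrable_comp_add_mul hf _ _ _ _)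
    (intervalIntegrable_comp_add_mul hg _ _ _ _)]
  rfl

/-- The Steklov average of `f` at `x` is dominated by the mean of `|f|` over the window of
width `δ` centred at `x`. -/
lemma enorm_steklov_le {f : ℝ → 𝕜} (hf : ∀ a b, IntervalIntegrable f volume a b) {δ : ℝ}
    (hδ : 0 < δ) {r : ℕ} (hr : 1 ≤ r) (x : ℝ) :
    ‖steklov δ r f x‖ₑ ≤ (2 * r * 4 ^ r) * ((ENNReal.ofReal δ)⁻¹ *
      ∫⁻ t in Set.Ioc (x - δ / 2) (x + δ / 2), ‖f t‖ₑ) := by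
  have hr0 : (0 : ℝ) < r := by exact_mod_cast hr
  have hint : IntegrableOn f (Set.Ioc (x - δ / 2) (x + δ / 2)) :=
    (intervalIntegrable_iff_integrableOn_Ioc_of_le (by linarith)).mp (hf _ _)
  set M := ∫ t in Set.Ioc (x - δ / 2) (x + δ / 2), ‖f t‖
  have hMe : ∫⁻ t in Set.Ioc (x - δ / 2) (x + δ / 2), ‖f t‖ₑ = ENNReal.ofReal M :=
    (ofReal_integral_norm_eq_lintegral_enorm hint).symm
  have hM0 : 0 ≤ M := integral_nonneg fun _ => norm_nonneg _
  have hterm : ∀ ν ∈ Finset.range r, ‖((-1 : ℝ) ^ ν * ((2 * r).choose ν : ℝ)) •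
      ∫ t in (-(δ / 2))..(δ / 2), f (x + ((r : ℝ) - ν) / r * t)‖ ≤
      ((2 * r).choose ν : ℝ) * (r * M) := by
    intro ν hν
    have hν' : (ν : ℝ) + 1 ≤ r := by exact_mod_cast Finset.mem_range.mp hν
    have hν0 : (0 : ℝ) ≤ ν := Nat.cast_nonneg ν
    set ρ := ((r : ℝ) - ν) / r with hρ
    have hρ1 : ρ ≤ 1 := by rw [hρ, div_le_one hr0]; linarith
    have hρ0 : 1 / r ≤ ρ := by rw [hρ]; gcongr; linarith
    have hρpos : 0 < ρ := lt_of_lt_of_le (by positivity) hρ0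
    rw [norm_smul, norm_mul, norm_pow, norm_neg, norm_one, one_pow, one_mul, Real.norm_natCast,
      intervalIntegral.integral_comp_add_mul _ hρpos.ne', norm_smul, norm_inv,
      Real.norm_of_nonneg hρpos.le]
    have h1 : ρ⁻¹ ≤ r := by
      rw [inv_le_comm₀ hρpos hr0]; simpa using hρ0
    gcongr
    refine intervalIntegral.norm_integral_le_integral_norm_uIoc.trans ?_
    refine setIntegral_mono_set hint.norm (Filter.Eventually.of_forall fun _ => norm_nonneg _)
      (LE.le.eventuallyLE ?_)
    have h2 : ρ * (δ / 2) ≤ δ / 2 := by nlinarith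
    have h3 : 0 ≤ ρ * (δ / 2) := by positivity
    refine Set.Ioc_subset_Ioc (le_min ?_ ?_) (max_le ?_ ?_) <;> linarith
  have hchoose : ∑ ν ∈ Finset.range r, ((2 * r).choose ν : ℝ) ≤ 4 ^ r := by
    have h := Nat.sum_range_choose (2 * r)
    have h4 : (4 : ℝ) ^ r = ((∑ ν ∈ Finset.range (2 * r + 1), (2 * r).choose ν : ℕ) : ℝ) := by
      rw [h, pow_mul]; norm_num
    rw [h4]
    push_cast
    exact Finset.sum_le_sum_of_subset_of_nonneg
      (Finset.range_subset_range.mpr (by omega)) fun _ _ _ => Nat.cast_nonneg _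
  have hcoef : ‖(-1 : ℝ) ^ (r + 1) * ((2 * r).choose r : ℝ)⁻¹ * (2 / δ)‖ ≤ 2 / δ := by
    rw [norm_mul, norm_mul, norm_pow, norm_neg, norm_one, one_pow, one_mul, norm_inv,
      Real.norm_natCast, Real.norm_of_nonneg (by positivity)]
    have h1 : (1 : ℝ) ≤ (2 * r).choose r := by
      exact_mod_cast Nat.choose_pos (by omega : r ≤ 2 * r)
    exact mul_le_of_le_one_left (by positivity) (inv_le_one_of_one_le₀ h1)
  have key : ‖steklov δ r f x‖ ≤ (2 * r * 4 ^ r) * (δ⁻¹ * M) := by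
    rw [steklov_eq hf, norm_smul]
    calc _ ≤ 2 / δ * ∑ ν ∈ Finset.range r, ((2 * r).choose ν : ℝ) * (r * M) := by
          gcongr
          exact norm_sum_le_of_le _ hterm
      _ ≤ 2 / δ * (4 ^ r * (r * M)) := by
          rw [← Finset.sum_mul]
          gcongr
      _ = _ := by rw [div_eq_mul_inv]; ring
  rw [hMe, ← ENNReal.ofReal_inv_of_pos hδ, ← ENNReal.ofReal_mul (by positivity), ← ofReal_norm]
  refine (ENNReal.ofReal_le_ofReal key).trans (le_of_eq ?_)
  rw [ENNReal.ofReal_mul (by positivity), ENNReal.ofReal_mul (by positivity),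
    ENNReal.ofReal_mul (by positivity), ENNReal.ofReal_pow (by positivity)]
  simp

/-- The error of the Steklov average is a mean of central differences of order `2 r`. -/
lemma steklov_sub_self {g : ℝ → 𝕜} (hg : ∀ a b, IntervalIntegrable g volume a b) {δ : ℝ}
    (hδ : 0 < δ) {r : ℕ} (hr : 1 ≤ r) (x : ℝ) :
    steklov δ r g x - g x = ((-1 : ℝ) ^ (r + 1) * ((2 * r).choose r : ℝ)⁻¹ * δ⁻¹) •
      ∫ t in (-(δ / 2))..(δ / 2), diff (2 * r) (t / r) g (x - t) := by
  have hr0 : (r : ℝ) ≠ 0 := by positivity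
  set J : ℕ → 𝕜 := fun ν => ((-1 : ℝ) ^ ν * ((2 * r).choose ν : ℝ)) •
    ∫ t in (-(δ / 2))..(δ / 2), g (x + ((r : ℝ) - ν) / r * t) with hJ
  have hdiff : ∫ t in (-(δ / 2))..(δ / 2), diff (2 * r) (t / r) g (x - t) =
      ∑ ν ∈ Finset.range (2 * r + 1), J ν := by
    have h1 : ∀ t : ℝ, diff (2 * r) (t / r) g (x - t) = ∑ ν ∈ Finset.range (2 * r + 1),
        ((-1 : ℝ) ^ ν * ((2 * r).choose ν : ℝ)) • g (x + ((r : ℝ) - ν) / r * t) := by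
      intro t
      refine Finset.sum_congr rfl fun ν _ => ?_
      congr 2
      push_cast
      field_simp
      ring
    simp only [h1]
    rw [intervalIntegral.integral_finsetSum]
    · simp only [intervalIntegral.integral_smul, hJ]
    · exact fun ν _ => intervalIntegrable_smul_comp_add_mul hg _ _ _ _ _
  have hmid : J r = ((-1 : ℝ) ^ r * ((2 * r).choose r : ℝ)) • δ • g x := by
    simp [hJ]
  -- The substitution `t ↦ -t` exchanges the terms with index `ν` and `2 r - ν`.
  have hrefl : ∀ ν, ν < r → J (2 * r - ν) = J ν := by
    intro ν hν
    have hle : ν ≤ 2 * r := by omega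
    simp only [hJ]
    rw [Nat.choose_symm hle]
    congr 1
    · congr 1
      exact neg_one_pow_congr (by grind)
    · have h := intervalIntegral.integral_comp_neg (a := -(δ / 2)) (b := δ / 2)
        (fun t => g (x + ((r : ℝ) - ν) / r * t))
      rw [neg_neg] at h
      rw [← h]
      congr 1
      ext t
      congr 2
      push_cast [Nat.cast_sub hle]
      ring
  have hsum : ∑ ν ∈ Finset.range (2 * r + 1), J ν = (2 : ℝ) • ∑ ν ∈ Finset.range r, J ν + J r := by
    have h1 : 2 * r + 1 = r + 1 + r := by ring
    rw [h1, Finset.sum_range_add, Finset.sum_range_succ, two_smul]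
    have h2 : ∑ i ∈ Finset.range r, J (r + 1 + i) = ∑ ν ∈ Finset.range r, J ν := by
      rw [← Finset.sum_range_reflect]
      refine Finset.sum_congr rfl fun ν hν => ?_
      have hν' := Finset.mem_range.mp hν
      rw [← hrefl ν hν']
      congr 1
      omega
    rw [h2]
    abel
  have hc : ((2 * r).choose r : ℝ) ≠ 0 := by
    exact_mod_cast (Nat.choose_pos (by omega : r ≤ 2 * r)).ne'
  rw [steklov_eq hg, hdiff, hsum, hmid, smul_add, smul_smul, smul_smul, smul_smul, sub_eq_add_neg]
  have hsign : (-1 : ℝ) ^ (r + 1) * (-1 : ℝ) ^ r = -1 := by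
    rw [← pow_add, show r + 1 + r = 2 * r + 1 by ring, pow_succ, pow_mul]; norm_num
  congr 1
  · congr 1
    field_simp
  · have : (-1 : ℝ) ^ (r + 1) * ((2 * r).choose r : ℝ)⁻¹ * δ⁻¹ *
        ((-1 : ℝ) ^ r * ((2 * r).choose r : ℝ)) * δ = -1 := by
      field_simp
      exact hsign
    rw [this]
    simp

/-- Since `s ≤ 2 r`, the Steklov average of a function in `W_p^s` has an error dominated by
`δ ^ s` times the mean of the `s`-th derivative over the window of width `δ`. -/
lemma enorm_steklov_sub_self_le {p : ℝ} (hp : 1 ≤ p) {r s : ℕ} (hr : 1 ≤ r) (hs : 1 ≤ s)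
    (hsr : s ≤ 2 * r) {g : ℝ → 𝕜} (hg : IsSobolev p s g) {δ : ℝ} (hδ : 0 < δ) (x : ℝ) :
    ‖steklov δ r g x - g x‖ₑ ≤ (4 ^ r * ENNReal.ofReal δ ^ s) * ((ENNReal.ofReal δ)⁻¹ *
      ∫⁻ t in Set.Ioc (x - δ / 2) (x + δ / 2), ‖iteratedDeriv s g t‖ₑ) := by
  have hr0 : (0 : ℝ) < r := by exact_mod_cast hr
  have hgc : Continuous g := hg.2.1.continuous
  set W := ∫⁻ t in Set.Ioc (x - δ / 2) (x + δ / 2), ‖iteratedDeriv s g t‖ₑ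
  set B : ℝ≥0∞ := 4 ^ r * (ENNReal.ofReal δ ^ (s - 1) * W) with hB
  have hbound : ∀ t ∈ Set.Ioc (-(δ / 2)) (δ / 2), ‖diff (2 * r) (t / r) g (x - t)‖ₑ ≤ B := by
    intro t ht
    have h2 : 2 * r = (2 * r - s) + s := by omega
    have h4 : (2 : ℝ≥0∞) ^ (2 * r - s) ≤ 4 ^ r := by
      calc (2 : ℝ≥0∞) ^ (2 * r - s) ≤ 2 ^ (2 * r) :=
            pow_le_pow_right₀ (by norm_num) (by omega)
        _ = 4 ^ r := by rw [pow_mul]; norm_num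
    rw [h2, diff_add]
    refine (enorm_diff_le (2 * r - s) (t / r) _ (x - t)
      (M := ENNReal.ofReal δ ^ (s - 1) * W) fun k hk => ?_).trans (by rw [hB]; gcongr)
    -- The stencil `x - t, …, x + t` stays in the window.
    have hmem : ∀ j : ℝ, 0 ≤ j → j ≤ 2 * r →
        x - t + j * (t / r) ∈ Set.Icc (x - δ / 2) (x + δ / 2) := fun j hj hj' =>
      add_mul_mem_of_convex (convex_Icc _ _) (K := 2 * r)
        ⟨by linarith [ht.2], by linarith [ht.1]⟩
        (by
          have : x - t + 2 * r * (t / r) = x + t := by field_simp; ring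
          rw [this]
          exact ⟨by linarith [ht.1], by linarith [ht.2]⟩) hj hj'
    have hks : (k : ℝ) + s ≤ 2 * r := by
      have : k + s ≤ 2 * r := by omega
      exact_mod_cast this
    have hs0 : (0 : ℝ) ≤ s := Nat.cast_nonneg s
    have hk0 : (0 : ℝ) ≤ k := Nat.cast_nonneg k
    refine (enorm_diff_le_of_isSobolev hp hs hg (by linarith) (hmem k hk0 (by linarith))
      ?_).trans ?_
    · have := hmem (k + s) (by positivity) hks
      convert this using 1
      ring
    · gcongr
      rw [← ofReal_norm]
      refine ENNReal.ofReal_le_ofReal ?_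
      have hr1 : (1 : ℝ) ≤ r := by exact_mod_cast hr
      rw [norm_div, Real.norm_natCast, Real.norm_eq_abs]
      refine (div_le_self (abs_nonneg t) hr1).trans (abs_le.mpr ⟨?_, ?_⟩) <;>
        linarith [ht.1, ht.2]
  have hcoef : ‖(-1 : ℝ) ^ (r + 1) * ((2 * r).choose r : ℝ)⁻¹ * δ⁻¹‖ₑ ≤
      (ENNReal.ofReal δ)⁻¹ := by
    rw [← ENNReal.ofReal_inv_of_pos hδ, ← ofReal_norm]
    refine ENNReal.ofReal_le_ofReal ?_
    rw [norm_mul, norm_mul, norm_pow, norm_neg, norm_one, one_pow, one_mul, norm_inv,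
      Real.norm_natCast, Real.norm_of_nonneg (by positivity : 0 ≤ δ⁻¹)]
    have h1 : (1 : ℝ) ≤ (2 * r).choose r := by
      exact_mod_cast Nat.choose_pos (by omega : r ≤ 2 * r)
    exact mul_le_of_le_one_left (by positivity) (inv_le_one_of_one_le₀ h1)
  rw [steklov_sub_self (fun a b => hgc.intervalIntegrable a b) hδ hr, enorm_smul,
    intervalIntegral.integral_of_le (by linarith)]
  calc _ ≤ (ENNReal.ofReal δ)⁻¹ * (∫⁻ t in Set.Ioc (-(δ / 2)) (δ / 2),
        ‖diff (2 * r) (t / r) g (x - t)‖ₑ) := by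
        gcongr
        exact enorm_integral_le_lintegral_enorm _
    _ ≤ (ENNReal.ofReal δ)⁻¹ * (∫⁻ _ in Set.Ioc (-(δ / 2)) (δ / 2), B) := by
        gcongr 1
        exact setLIntegral_mono' measurableSet_Ioc hbound
    _ = (ENNReal.ofReal δ)⁻¹ * (B * ENNReal.ofReal δ) := by
        rw [setLIntegral_const, Real.volume_Ioc]
        congr 4
        ring
    _ = _ := by
        obtain ⟨m, rfl⟩ := Nat.exists_eq_add_of_le' hs
        simp only [hB, Nat.add_sub_cancel, pow_succ]
        ring

/-! ### Smoothing by iterated averages -/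

/-- The mean of `u` over the interval from `x` to `x + d`, written as an integral over `[0, 1]` so
that `d = 0` gives `u` itself. -/
noncomputable def average (d : ℝ) (u : ℝ → 𝕜) (x : ℝ) : 𝕜 := ∫ t in (0 : ℝ)..1, u (x + d * t)

lemma average_zero (u : ℝ → 𝕜) : average 0 u = u := by
  ext x
  simp [average]

lemma average_iterate_zero (m : ℕ) (u : ℝ → 𝕜) : (average 0)^[m] u = u := by
  induction m with
  | zero => rfl
  | succ m ih => rw [Function.iterate_succ_apply, average_zero, ih]

lemma average_const_smul (d c : ℝ) (u : ℝ → 𝕜) :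
    average d (fun x => c • u x) = fun x => c • average d u x := by
  ext x
  simp [average, intervalIntegral.integral_smul]

lemma average_iterate_const_smul (m : ℕ) (d c : ℝ) (u : ℝ → 𝕜) :
    (average d)^[m] (fun x => c • u x) = fun x => c • (average d)^[m] u x := by
  induction m generalizing u with
  | zero => rfl
  | succ m ih => simp only [Function.iterate_succ_apply, average_const_smul, ih]

lemma average_periodic {u : ℝ → 𝕜} (hu : Function.Periodic u 1) (d : ℝ) :
    Function.Periodic (average d u) 1 := fun x => by
  simp only [average]
  congr 1
  ext t
  rw [add_right_comm, hu]

lemma average_eq {u : ℝ → 𝕜} {d : ℝ} (hd : d ≠ 0) (hu : ∀ a b, IntervalIntegrable u volume a b)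
    (x : ℝ) : average d u x = d⁻¹ • ((∫ t in (0 : ℝ)..(x + d), u t) - ∫ t in (0 : ℝ)..x, u t) := by
  rw [average, intervalIntegral.integral_comp_add_mul _ hd,
    intervalIntegral.integral_interval_sub_left (hu _ _) (hu _ _)]
  simp

lemma continuous_average {u : ℝ → 𝕜} {d : ℝ} (hd : d ≠ 0)
    (hu : ∀ a b, IntervalIntegrable u volume a b) : Continuous (average d u) := by
  have h := intervalIntegral.continuous_primitive hu 0
  have h2 : average d u = fun x =>
      d⁻¹ • ((∫ t in (0 : ℝ)..(x + d), u t) - ∫ t in (0 : ℝ)..x, u t) :=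
    funext (average_eq hd hu)
  rw [h2]
  exact ((h.comp (continuous_add_const d)).sub h).const_smul _

lemma hasDerivAt_average {u : ℝ → 𝕜} {d : ℝ} (hd : d ≠ 0) (hu : Continuous u) (x : ℝ) :
    HasDerivAt (average d u) (d⁻¹ • (u (x + d) - u x)) x := by
  have h2 : average d u = fun x =>
      d⁻¹ • ((∫ t in (0 : ℝ)..(x + d), u t) - ∫ t in (0 : ℝ)..x, u t) :=
    funext (average_eq hd fun a b => hu.intervalIntegrable a b)
  rw [h2]
  have h := fun y => hu.integral_hasStrictDerivAt 0 y
  exact (((h (x + d)).hasDerivAt.comp_add_const x d).sub (h x).hasDerivAt).const_smul d⁻¹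

/-- Averaging `m` times gains `m` derivatives, and the `m`-th derivative is a difference quotient
of order `m`. -/
lemma average_iterate_smooth {d : ℝ} (hd : d ≠ 0) (m : ℕ) {v : ℝ → 𝕜} (hv : Continuous v) :
    ContDiff ℝ m ((average d)^[m] v) ∧
      iteratedDeriv m ((average d)^[m] v) = fun x => (d⁻¹) ^ m • diff m d v x := by
  induction m with
  | zero =>
    refine ⟨by simpa using (contDiff_zero (𝕜 := ℝ)).mpr hv, ?_⟩
    simp [diff_zero]
  | succ m ih =>
    obtain ⟨hC, hD⟩ := ih
    rw [Function.iterate_succ_apply']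
    set w := (average d)^[m] v
    have hder : deriv (average d w) = fun x => d⁻¹ • (w (x + d) - w x) :=
      funext fun x => (hasDerivAt_average hd hC.continuous x).deriv
    have hdC : ContDiff ℝ m (fun x => w (x + d) - w x) :=
      (hC.comp (contDiff_id.add contDiff_const)).sub hC
    constructor
    · push_cast
      rw [contDiff_succ_iff_deriv]
      refine ⟨fun x => (hasDerivAt_average hd hC.continuous x).differentiableAt, by simp, ?_⟩
      rw [hder]
      exact hdC.const_smul d⁻¹
    · ext x
      rw [iteratedDeriv_succ', hder]
      have h1 := iteratedDeriv_fun_const_smul (n := m) (x := x) hdC.contDiffAt d⁻¹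
      rw [h1, iteratedDeriv_comp_add_sub hC, hD, diff_succ, pow_succ', ← smul_smul]
      simp only [smul_sub]

/-- Minkowski's inequality: an average over a parameter has norm at most the supremum of the norms
of the averaged functions. -/
lemma normLp_average_sum_le {p : ℝ} (hp : 1 ≤ p) {ι : Type*} (S : Finset ι) {F : ι → ℝ → 𝕜}
    (hF : ∀ j ∈ S, IsLp p (F j)) (d : ι → ℝ) {M : ℝ≥0∞}
    (hM : ∀ t ∈ Set.Ioc (0 : ℝ) 1, normLp p (fun x => ∑ j ∈ S, F j (x + d j * t)) ≤ M) :
    normLp p (fun x => ∑ j ∈ S, average (d j) (F j) x) ≤ M := by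
  have hp0 : 0 ≤ p := by linarith
  have hpt : ∀ x, ‖∑ j ∈ S, average (d j) (F j) x‖ₑ ≤
      ∫⁻ t in Set.Ioc (0 : ℝ) 1, ‖∑ j ∈ S, F j (x + d j * t)‖ₑ := by
    intro x
    simp only [average]
    rw [← intervalIntegral.integral_finsetSum fun j hj =>
      intervalIntegrable_comp_add_mul ((hF j hj).intervalIntegrable hp) _ _ _ _,
      intervalIntegral.integral_of_le zero_le_one]
    exact enorm_integral_le_lintegral_enorm _
  rw [normLp_le_iff hp]
  refine (lintegral_mono fun x => ENNReal.rpow_le_rpow (hpt x) hp0).trans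
    (lintegral_average_rpow_le hp ?_ fun t ht => ?_)
  · refine AEStronglyMeasurable.enorm (f := fun z : ℝ × ℝ => ∑ j ∈ S, F j (z.1 + d j * z.2)) ?_
    exact Finset.aestronglyMeasurable_fun_sum S fun j hj =>
      (hF j hj).aestronglyMeasurable.comp_quasiMeasurePreserving
        (quasiMeasurePreserving_add_mul _ _ _)
  · exact (normLp_le_iff hp _ _).mp (hM t ht)

lemma IsLp.average {p : ℝ} (hp : 1 ≤ p) {u : ℝ → 𝕜} (hu : IsLp p u) (d : ℝ) :
    IsLp p (average d u) := by
  rcases eq_or_ne d 0 with rfl | hd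
  · rwa [average_zero]
  · exact IsLp.of_continuous (continuous_average hd (hu.intervalIntegrable hp))
      (average_periodic hu.1 d)

/-- The iterated form of `normLp_average_sum_le`: after `m` averages with steps proportional to
`d j`, the parameter ranges over `[0, m]`. -/
lemma normLp_sum_average_iterate_le {p : ℝ} (hp : 1 ≤ p) {ι : Type*} (S : Finset ι) (d : ι → ℝ)
    (m : ℕ) {F : ι → ℝ → 𝕜} (hF : ∀ j ∈ S, IsLp p (F j)) {M : ℝ≥0∞}
    (hM : ∀ τ ∈ Set.Icc (0 : ℝ) m, normLp p (fun x => ∑ j ∈ S, F j (x + d j * τ)) ≤ M) :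
    normLp p (fun x => ∑ j ∈ S, (average (d j))^[m] (F j) x) ≤ M := by
  induction m generalizing F with
  | zero => simpa using hM 0 (by simp)
  | succ m ih =>
    simp only [Function.iterate_succ_apply]
    refine ih (fun j hj => (hF j hj).average hp (d j)) fun τ hτ => ?_
    have hshift : ∀ j x, average (d j) (F j) (x + d j * τ) =
        average (d j) (fun y => F j (y + d j * τ)) x := fun j x => by
      simp only [average]
      congr 1
      ext t
      congr 1
      ring
    simp only [hshift]
    refine normLp_average_sum_le hp S (fun j hj => (hF j hj).comp_add_right hp _) d
      fun t ht => ?_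
    have h := hM (τ + t) ⟨by linarith [hτ.1, ht.1], by push_cast; linarith [hτ.2, ht.2]⟩
    refine le_trans (le_of_eq ?_) h
    congr 1
    ext x
    refine Finset.sum_congr rfl fun j _ => ?_
    congr 1
    ring

lemma normLp_diff_le_modulus {s : ℕ} (f : ℝ → 𝕜) {h δ : ℝ} (hh : 0 < h) (hδ : h < δ) (p : ℝ) :
    normLp p (diff s h f) ≤ modulus s f δ p :=
  le_iSup₂_of_le h ⟨hh, hδ⟩ le_rfl

lemma diff_eq_sum (s : ℕ) (h : ℝ) (f : ℝ → 𝕜) (x : ℝ) : diff s h f x =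
    ∑ j ∈ Finset.range (s + 1), ((-1 : ℝ) ^ (s - j) * (s.choose j : ℝ)) • f (x + j * h) := by
  rw [diff, ← Finset.sum_range_reflect]
  refine Finset.sum_congr rfl fun k hk => ?_
  have hk' : k ≤ s := by simpa [Nat.lt_succ_iff] using hk
  have h1 : s + 1 - 1 - k = s - k := by omega
  rw [h1, Nat.choose_symm hk', Nat.cast_sub hk']
  congr 3
  ring

lemma normLp_diff_average_le {p : ℝ} (hp : 1 ≤ p) {f : ℝ → 𝕜} (hf : IsLp p f) (s : ℕ) (h d : ℝ) :
    normLp p (diff s h (average d f)) ≤ normLp p (diff s h f) := by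
  have hcomm : diff s h (average d f) = fun x => ∑ _j ∈ ({()} : Finset Unit),
      average d (diff s h f) x := by
    ext x
    simp only [Finset.sum_singleton, diff, average]
    rw [intervalIntegral.integral_finsetSum fun j _ => by
      exact intervalIntegrable_smul_comp_add_mul
        ((hf.comp_add_right hp _).intervalIntegrable hp) _ x d 0 1]
    refine Finset.sum_congr rfl fun ν _ => ?_
    rw [intervalIntegral.integral_smul]
    congr 2
    ext t
    congr 1
    ring
  rw [hcomm]
  refine normLp_average_sum_le hp _ (fun _ _ => hf.diff hp s h) (fun _ => d) fun t _ => ?_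
  simp only [Finset.sum_singleton]
  exact (normLp_comp_add_right hp (hf.diff hp s h).1 _).le

/-- A smooth approximation realizing the modulus of smoothness. It combines the averages
`(average (j h))^[s + 1] f` for `j = 1, …, s` with the coefficients of `Δ_h^s`, so that `f - g` is
an average of differences of order `s` of `f`. -/
lemma exists_isSobolev_approx {p : ℝ} (hp : 1 ≤ p) {s : ℕ} (hs : 1 ≤ s) {f : ℝ → 𝕜}
    (hf : IsLp p f) {δ : ℝ} (hδ : 0 < δ) :
    ∃ g : ℝ → 𝕜, IsSobolev p s g ∧ normLp p (f - g) ≤ modulus s f δ p ∧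
      normLp p (iteratedDeriv s g) ≤
        ENNReal.ofReal (2 ^ s * ((s + 2) / δ) ^ s) * modulus s f δ p := by
  -- The `s + 1` averages with step `h` involve parameters up to `(s + 1) h < δ`.
  set h : ℝ := δ / (s + 2) with hh
  have hs2 : (0 : ℝ) < s + 2 := by positivity
  have hh0 : 0 < h := by positivity
  have hhδ : (s + 2) * h = δ := by rw [hh]; field_simp
  set a : ℕ → ℝ := fun j => (-1) ^ (s - j) * (s.choose j : ℝ) with ha
  set A : ℕ → ℝ → 𝕜 := fun j => (average (j * h))^[s + 1] f with hA
  have hd : ∀ j ∈ Finset.Icc 1 s, (j : ℝ) * h ≠ 0 := fun j hj => by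
    have : 1 ≤ j := (Finset.mem_Icc.mp hj).1
    positivity
  have hav : ∀ j ∈ Finset.Icc 1 s, Continuous (average (j * h) f) := fun j hj =>
    continuous_average (hd j hj) (hf.intervalIntegrable hp)
  have hsm : ∀ j ∈ Finset.Icc 1 s, ContDiff ℝ s (A j) ∧
      iteratedDeriv s (A j) = fun x => ((j * h)⁻¹) ^ s • diff s (j * h) (average (j * h) f) x :=
    fun j hj => by
      simp only [hA, Function.iterate_succ_apply]
      exact average_iterate_smooth (hd j hj) s (hav j hj)
  have hApi : ∀ j m, IsLp p ((average (j * h))^[m] f) := fun j m => by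
    induction m with
    | zero => exact hf
    | succ m ih => rw [Function.iterate_succ_apply']; exact ih.average hp _
  set c : ℕ → ℝ := fun j => -((-1) ^ s * a j) with hc
  set g : ℝ → 𝕜 := fun x => ∑ j ∈ Finset.Icc 1 s, c j • A j x with hg
  have hgC : ContDiff ℝ s g := ContDiff.sum fun j hj => (hsm j hj).1.const_smul (c j)
  have hgper : Function.Periodic g 1 := fun x => by
    simp only [hg]
    exact Finset.sum_congr rfl fun j _ => by rw [show A j (x + 1) = A j x from (hApi j (s + 1)).1 x]
  have hgD : iteratedDeriv s g = fun x => ∑ j ∈ Finset.Icc 1 s,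
      (c j * ((j * h)⁻¹) ^ s) • diff s (j * h) (average (j * h) f) x := by
    ext x
    rw [hg, iteratedDeriv_fun_sum fun j hj => ((hsm j hj).1.const_smul (c j)).contDiffAt]
    refine Finset.sum_congr rfl fun j hj => ?_
    have h1 := iteratedDeriv_fun_const_smul (n := s) (x := x) (hsm j hj).1.contDiffAt (c j)
    rw [h1, (hsm j hj).2, smul_smul]
  have hterm : ∀ j, IsLp p (diff s (j * h) (average (j * h) f)) := fun j =>
    (hf.average hp _).diff hp _ _
  refine ⟨g, ⟨hgper, hgC.of_le (by exact_mod_cast Nat.sub_le s 1), fun x y => ?_, ?_⟩, ?_, ?_⟩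
  · have h1 : ContDiff ℝ 1 (iteratedDeriv (s - 1) g) := by
      have h2 : ContDiff ℝ ((1 + (s - 1) : ℕ) : WithTop ℕ∞) g := by
        rwa [Nat.add_sub_cancel' hs]
      rw [iteratedDeriv_eq_iterate]
      exact ContDiff.iterate_deriv' 1 (s - 1) (by exact_mod_cast h2)
    exact h1.contDiffOn.absolutelyContinuousOnInterval
  · rw [hgD]
    exact IsLp.sum _ fun j _ => (hterm j).const_smul _
  · have hfg : f - g = fun x => (-1 : ℝ) ^ s • ∑ j ∈ Finset.range (s + 1),
        (average (j * h))^[s + 1] (fun y => a j • f y) x := by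
      ext x
      simp only [average_iterate_const_smul]
      rw [Finset.range_eq_Ico, Finset.sum_eq_sum_Ico_succ_bot (by omega), Pi.sub_apply, hg]
      simp only [Nat.cast_zero, zero_mul, average_iterate_zero]
      rw [smul_add, smul_smul, sub_eq_add_neg, Finset.smul_sum, ← Finset.sum_neg_distrib]
      congr 1
      · simp [ha, ← mul_pow]
      · refine Finset.sum_congr rfl fun j _ => ?_
        simp only [hc, hA, neg_smul, neg_neg, smul_smul]
    rw [hfg, normLp_const_smul]
    have hone : ‖(-1 : ℝ) ^ s‖ₑ = 1 := by simp [enorm_pow]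
    rw [hone, one_mul]
    refine normLp_sum_average_iterate_le hp _ (fun j : ℕ => (j : ℝ) * h) (s + 1)
      (F := fun j y => a j • f y) (fun j _ => hf.const_smul _) fun τ hτ => ?_
    have hdiff : (fun x => ∑ j ∈ Finset.range (s + 1), a j • f (x + j * h * τ)) =
        diff s (h * τ) f := by
      ext x
      rw [diff_eq_sum]
      simp only [ha, mul_assoc]
    rw [hdiff]
    rcases hτ.1.eq_or_lt with h0 | h0
    · have hz : diff s (h * τ) f = fun _ => 0 := by
        ext x
        rw [← h0, mul_zero, diff_step_zero hs]
      rw [hz, normLp, eLpNorm_zero']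
      exact zero_le
    · refine normLp_diff_le_modulus f (by positivity) ?_ p
      have := hτ.2
      push_cast at this
      nlinarith
  · rw [hgD]
    refine (normLp_sum_le hp _ (F := fun (j : ℕ) x => (c j * ((j * h)⁻¹) ^ s) •
      diff s (j * h) (average (j * h) f) x) fun j _ => (hterm j).const_smul _).trans ?_
    have hbd : ∀ j ∈ Finset.Icc 1 s, normLp p (fun x => (c j * ((j * h)⁻¹) ^ s) •
        diff s (j * h) (average (j * h) f) x) ≤
        ENNReal.ofReal (s.choose j * ((s + 2) / δ) ^ s) * modulus s f δ p := by
      intro j hj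
      obtain ⟨hj1, hjs⟩ := Finset.mem_Icc.mp hj
      have hj1' : (1 : ℝ) ≤ j := by exact_mod_cast hj1
      have hjs' : (j : ℝ) ≤ s := by exact_mod_cast hjs
      rw [normLp_const_smul]
      refine mul_le_mul' ?_ ?_
      · rw [← ofReal_norm]
        refine ENNReal.ofReal_le_ofReal ?_
        simp only [hc, ha]
        rw [norm_mul, norm_neg, norm_mul, norm_mul, norm_pow, norm_pow, norm_neg, norm_one, one_pow,
          one_pow, one_mul, one_mul, Real.norm_natCast, norm_pow, norm_inv,
          Real.norm_of_nonneg (by positivity)]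
        gcongr
        rw [← inv_div, ← hh]
        exact inv_anti₀ hh0 (le_mul_of_one_le_left hh0.le hj1')
      · refine (normLp_diff_average_le hp hf s _ _).trans
          (normLp_diff_le_modulus f (by positivity) ?_ p)
        nlinarith
    refine (Finset.sum_le_sum hbd).trans ?_
    rw [← Finset.sum_mul, ← ENNReal.ofReal_sum_of_nonneg fun j _ => by positivity,
      ← Finset.sum_mul]
    refine mul_le_mul_left (ENNReal.ofReal_le_ofReal ?_) _
    refine mul_le_mul_of_nonneg_right ?_ (by positivity)
    have h2 : (2 : ℝ) ^ s = ∑ j ∈ Finset.range (s + 1), (s.choose j : ℝ) := by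
      exact_mod_cast (Nat.sum_range_choose s).symm
    rw [h2]
    refine Finset.sum_le_sum_of_subset_of_nonneg (fun j hj => ?_) fun _ _ _ => Nat.cast_nonneg _
    simp only [Finset.mem_Icc, Finset.mem_range] at hj ⊢
    omega

/-! ### Comparison with the semi-discrete `K`-functional -/

lemma normDiscrete_steklov_le {p : ℝ} (hp : 1 ≤ p) {r : ℕ} (hr : 1 ≤ r) {γ : ℝ}
    (hγ : γ ∈ Set.Ioc (0 : ℝ) 1) {X : (n : ℕ) → Fin n → ℝ} (hX : IsNodeSystem γ X) {n : ℕ}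
    (hn : 1 ≤ n) {f : ℝ → 𝕜} (hf : IsLp p f) :
    normDiscrete p (X n) (steklov (γ / n) r f) ≤
      ENNReal.ofReal (2 * r * 4 ^ r * γ⁻¹) * normLp p f := by
  have hn0 : (0 : ℝ) < n := by exact_mod_cast hn
  refine (hX.normDiscrete_le hp hγ hn hf fun k =>
    enorm_steklov_le (hf.intervalIntegrable hp) (div_pos hγ.1 hn0) hr (X n k)).trans (le_of_eq ?_)
  rw [ENNReal.ofReal_mul (by positivity), ENNReal.ofReal_mul (by positivity),
    ENNReal.ofReal_mul (by positivity), ENNReal.ofReal_pow (by positivity)]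
  simp

lemma normDiscrete_steklov_sub_self_le {p : ℝ} (hp : 1 ≤ p) {r s : ℕ} (hr : 1 ≤ r) (hs : 1 ≤ s)
    (hsr : s ≤ 2 * r) {γ : ℝ} (hγ : γ ∈ Set.Ioc (0 : ℝ) 1) {X : (n : ℕ) → Fin n → ℝ}
    (hX : IsNodeSystem γ X) {n : ℕ} (hn : 1 ≤ n) {g : ℝ → 𝕜} (hg : IsSobolev p s g) :
    normDiscrete p (X n) (steklov (γ / n) r g - g) ≤
      ENNReal.ofReal (4 ^ r * γ⁻¹) * (((n : ℝ≥0∞) ^ s)⁻¹ * normLp p (iteratedDeriv s g)) := by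
  have hn0 : (0 : ℝ) < n := by exact_mod_cast hn
  refine (hX.normDiscrete_le hp hγ hn hg.2.2.2 fun k =>
    enorm_steklov_sub_self_le hp hr hs hsr hg (div_pos hγ.1 hn0) (X n k)).trans ?_
  have hδ : ENNReal.ofReal (γ / n) ^ s ≤ ((n : ℝ≥0∞) ^ s)⁻¹ := by
    rw [ENNReal.inv_pow]
    gcongr
    rw [← ENNReal.ofReal_natCast, ← ENNReal.ofReal_inv_of_pos hn0]
    refine ENNReal.ofReal_le_ofReal ?_
    rw [div_eq_mul_inv]
    exact mul_le_of_le_one_left (by positivity) hγ.2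
  have h4 : ENNReal.ofReal (4 ^ r * γ⁻¹) = 4 ^ r * ENNReal.ofReal γ⁻¹ := by
    rw [ENNReal.ofReal_mul (by positivity), ENNReal.ofReal_pow (by positivity)]
    simp
  rw [h4]
  calc 4 ^ r * ENNReal.ofReal (γ / n) ^ s * ENNReal.ofReal γ⁻¹ * normLp p (iteratedDeriv s g)
      = 4 ^ r * ENNReal.ofReal γ⁻¹ *
        (ENNReal.ofReal (γ / n) ^ s * normLp p (iteratedDeriv s g)) := by ring
    _ ≤ _ := by gcongr

lemma modulus_le {p : ℝ} (hp : 1 ≤ p) {s : ℕ} (hs : 1 ≤ s) {f g : ℝ → 𝕜} (hf : IsLp p f)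
    (hg : IsSobolev p s g) {n : ℕ} (hn : 1 ≤ n) :
    modulus s f (1 / n) p ≤
      2 ^ s * normLp p (f - g) + s * (((n : ℝ≥0∞) ^ s)⁻¹ * normLp p (iteratedDeriv s g)) := by
  have hn0 : (0 : ℝ) < n := by exact_mod_cast hn
  have hgLp : IsLp p g := IsLp.of_continuous hg.2.1.continuous hg.1
  refine iSup₂_le fun h hh => ?_
  have hsplit : diff s h f = diff s h (f - g) + diff s h g := by
    rw [diff_sub, sub_add_cancel]
  rw [hsplit]
  refine (normLp_add_le hp ((hf.sub hgLp).diff hp s h) (hgLp.diff hp s h)).trans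
    (add_le_add (normLp_diff_le hp (hf.sub hgLp) s h)
      ((normLp_diff_le_of_isSobolev hp hs hg hh.1).trans ?_))
  rw [mul_assoc, ENNReal.inv_pow]
  gcongr
  rw [← ENNReal.ofReal_natCast, ← ENNReal.ofReal_inv_of_pos hn0]
  refine ENNReal.ofReal_le_ofReal ?_
  simpa using hh.2.le

lemma steklov_sub_of_isSobolev {p : ℝ} (hp : 1 ≤ p) {s : ℕ} {f g : ℝ → 𝕜} (hf : IsLp p f)
    (hg : IsSobolev p s g) (δ : ℝ) (r : ℕ) :
    steklov δ r (f - g) = steklov δ r f - steklov δ r g :=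
  steklov_sub (hf.intervalIntegrable hp)
    (fun a b => hg.2.1.continuous.intervalIntegrable a b) _ _

/-- The lower bound for the `K`-functional: every `g ∈ W_p^s` is an admissible competitor in the
estimates of the Steklov error and of the modulus of smoothness. -/
lemma normDiscrete_add_modulus_le_semiK {p : ℝ} (hp : 1 ≤ p) {r s : ℕ} (hr : 1 ≤ r) (hs : 1 ≤ s)
    (hsr : s ≤ 2 * r) {γ : ℝ} (hγ : γ ∈ Set.Ioc (0 : ℝ) 1) {X : (n : ℕ) → Fin n → ℝ}
    (hX : IsNodeSystem γ X) {f : ℝ → 𝕜} (hf : IsLp p f) {n : ℕ} (hn : 1 ≤ n) :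
    normDiscrete p (X n) (steklov (γ / n) r f - f) + modulus s f (1 / n) p ≤
      ENNReal.ofReal (1 + 2 * r * 4 ^ r * γ⁻¹ + 4 ^ r * γ⁻¹ + 2 ^ s + s) * semiK p s (X n) f := by
  have hγ0 : 0 < γ := hγ.1
  set K₁ : ℝ := 2 * r * 4 ^ r * γ⁻¹
  set K₂ : ℝ := 4 ^ r * γ⁻¹
  have hK₁0 : 0 ≤ K₁ := by positivity
  have hK₂0 : 0 ≤ K₂ := by positivity
  set L : ℝ := 1 + K₁ + K₂ + 2 ^ s + s with hL
  have hL0 : 0 < L := by positivity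
  rw [semiK, ENNReal.mul_iInf_of_ne (by simpa using hL0) ENNReal.ofReal_ne_top]
  refine le_iInf fun g => ?_
  rw [ENNReal.mul_iInf_of_ne (by simpa using hL0) ENNReal.ofReal_ne_top]
  refine le_iInf fun hg => ?_
  have hgLp : IsLp p g := IsLp.of_continuous hg.2.1.continuous hg.1
  have hmod := modulus_le hp hs hf hg hn
  have h1 := normDiscrete_steklov_le hp hr hγ hX hn (hf.sub hgLp)
  have h2 := normDiscrete_steklov_sub_self_le hp hr hs hsr hγ hX hn hg
  have hsplit : steklov (γ / n) r f - f =
      (steklov (γ / n) r (f - g) + (steklov (γ / n) r g - g)) + (g - f) := by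
    rw [steklov_sub_of_isSobolev hp hf hg]; abel
  have h3 : normDiscrete p (X n) (steklov (γ / n) r f - f) ≤
      normDiscrete p (X n) (steklov (γ / n) r (f - g)) +
        normDiscrete p (X n) (steklov (γ / n) r g - g) + normDiscrete p (X n) (f - g) := by
    rw [hsplit, normDiscrete_congr_enorm (X n) (f := f - g) (g := g - f) fun y => by
      rw [Pi.sub_apply, Pi.sub_apply, enorm_sub_rev]]
    exact (normDiscrete_add_le hp _ _ _).trans
      (add_le_add_left (normDiscrete_add_le hp _ _ _) _)
  set A := normDiscrete p (X n) (f - g)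
  set B := normLp p (f - g)
  set D := ((n : ℝ≥0∞) ^ s)⁻¹ * normLp p (iteratedDeriv s g)
  have hLe : ENNReal.ofReal L = 1 + ENNReal.ofReal K₁ + ENNReal.ofReal K₂ + 2 ^ s + s := by
    rw [hL, ENNReal.ofReal_add (by positivity) (by positivity),
      ENNReal.ofReal_add (by positivity) (by positivity), ENNReal.ofReal_add (by positivity) hK₂0,
      ENNReal.ofReal_add (by positivity) hK₁0, ENNReal.ofReal_pow (by positivity)]
    simp
  calc normDiscrete p (X n) (steklov (γ / n) r f - f) + modulus s f (1 / n) p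
      ≤ (ENNReal.ofReal K₁ * B + ENNReal.ofReal K₂ * D + A) + (2 ^ s * B + s * D) := by
        refine add_le_add (h3.trans ?_) hmod
        gcongr
    -- The added terms complete the product `L (A + B + D)`.
    _ ≤ (ENNReal.ofReal K₁ * B + ENNReal.ofReal K₂ * D + A) + (2 ^ s * B + s * D) +
        (B + D + (ENNReal.ofReal K₁ + ENNReal.ofReal K₂ + 2 ^ s + s) * A +
          (ENNReal.ofReal K₁ + 2 ^ s) * D + (ENNReal.ofReal K₂ + s) * B) := le_self_add
    _ = ENNReal.ofReal L * (A + B + D) := by rw [hLe]; ring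

/-- The upper bound for the `K`-functional, by inserting the smooth approximation of `f` at scale
`1 / n`. -/
lemma semiK_le_normDiscrete_add_modulus {p : ℝ} (hp : 1 ≤ p) {r s : ℕ} (hr : 1 ≤ r) (hs : 1 ≤ s)
    (hsr : s ≤ 2 * r) {γ : ℝ} (hγ : γ ∈ Set.Ioc (0 : ℝ) 1) {X : (n : ℕ) → Fin n → ℝ}
    (hX : IsNodeSystem γ X) {f : ℝ → 𝕜} (hf : IsLp p f) {n : ℕ} (hn : 1 ≤ n) :
    semiK p s (X n) f ≤
      ENNReal.ofReal (1 + (2 * r * 4 ^ r * γ⁻¹ + 1) +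
        (4 ^ r * γ⁻¹ + 1) * (2 ^ s * (s + 2) ^ s)) *
      (normDiscrete p (X n) (steklov (γ / n) r f - f) + modulus s f (1 / n) p) := by
  have hγ0 : 0 < γ := hγ.1
  have hn0 : (0 : ℝ) < n := by exact_mod_cast hn
  set K₁ : ℝ := 2 * r * 4 ^ r * γ⁻¹
  set K₂ : ℝ := 4 ^ r * γ⁻¹
  have hK₁0 : 0 ≤ K₁ := by positivity
  have hK₂0 : 0 ≤ K₂ := by positivity
  set Q : ℝ := 2 ^ s * (s + 2) ^ s with hQ
  obtain ⟨g, hg, hfg, hgs⟩ := exists_isSobolev_approx hp hs hf (δ := 1 / (n : ℝ)) (by positivity)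
  have hgLp : IsLp p g := IsLp.of_continuous hg.2.1.continuous hg.1
  have h1 := normDiscrete_steklov_le hp hr hγ hX hn (hf.sub hgLp)
  have h2 := normDiscrete_steklov_sub_self_le hp hr hs hsr hγ hX hn hg
  have hsplit : f - g = ((f - steklov (γ / n) r f) + steklov (γ / n) r (f - g)) +
      (steklov (γ / n) r g - g) := by
    rw [steklov_sub_of_isSobolev hp hf hg]; abel
  set E := normDiscrete p (X n) (steklov (γ / n) r f - f)
  set w := modulus s f (1 / n) p
  have h3 : normDiscrete p (X n) (f - g) ≤ E +
      normDiscrete p (X n) (steklov (γ / n) r (f - g)) +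
        normDiscrete p (X n) (steklov (γ / n) r g - g) := by
    have hE : E = normDiscrete p (X n) (f - steklov (γ / n) r f) :=
      normDiscrete_congr_enorm (X n) fun y => by
        rw [Pi.sub_apply, Pi.sub_apply, enorm_sub_rev]
    rw [hE]
    conv_lhs => rw [hsplit]
    exact (normDiscrete_add_le hp _ _ _).trans
      (add_le_add_left (normDiscrete_add_le hp _ _ _) _)
  have hD : ((n : ℝ≥0∞) ^ s)⁻¹ * normLp p (iteratedDeriv s g) ≤ ENNReal.ofReal Q * w := by
    refine (mul_le_mul_right hgs _).trans (le_of_eq ?_)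
    rw [← mul_assoc, ← ENNReal.ofReal_natCast, ← ENNReal.ofReal_pow hn0.le,
      ← ENNReal.ofReal_inv_of_pos (by positivity), ← ENNReal.ofReal_mul (by positivity)]
    congr 2
    rw [hQ, div_div_eq_mul_div, div_one, mul_pow]
    field_simp
  have hC : ENNReal.ofReal (1 + (K₁ + 1) + (K₂ + 1) * Q) =
      1 + (ENNReal.ofReal K₁ + 1) + (ENNReal.ofReal K₂ + 1) * ENNReal.ofReal Q := by
    rw [ENNReal.ofReal_add (by positivity) (by positivity),
      ENNReal.ofReal_add (by positivity) (by positivity), ENNReal.ofReal_add hK₁0 (by positivity),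
      ENNReal.ofReal_mul (p := K₂ + 1) (by positivity), ENNReal.ofReal_add hK₂0 (by positivity)]
    simp
  calc semiK p s (X n) f
      ≤ normDiscrete p (X n) (f - g) + normLp p (f - g) +
        ((n : ℝ≥0∞) ^ s)⁻¹ * normLp p (iteratedDeriv s g) := iInf₂_le g hg
    _ ≤ (E + ENNReal.ofReal K₁ * w + ENNReal.ofReal K₂ * (ENNReal.ofReal Q * w)) + w +
        ENNReal.ofReal Q * w := by
        gcongr
        refine h3.trans ?_
        gcongr
        · exact h1.trans (mul_le_mul_right hfg _)
        · exact h2.trans (mul_le_mul_right hD _)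
    -- The added terms complete the product with `E + w`.
    _ ≤ (E + ENNReal.ofReal K₁ * w + ENNReal.ofReal K₂ * (ENNReal.ofReal Q * w)) + w +
        ENNReal.ofReal Q * w + (w + ((ENNReal.ofReal K₁ + 1) +
          (ENNReal.ofReal K₂ + 1) * ENNReal.ofReal Q) * E) := le_self_add
    _ = _ := by rw [hC]; ring

end SemiDiscrete

theorem mainTheorem2 {𝕜 : Type*} [RCLike 𝕜] (p : ℝ) (hp : 1 ≤ p) (r s : ℕ) (hr : 1 ≤ r)
    (hs : 1 ≤ s) (hsr : s ≤ 2 * r) (γ : ℝ) (hγ : γ ∈ Set.Ioc (0 : ℝ) 1) :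
    ∃ c C : ℝ, 0 < c ∧ 0 < C ∧
      ∀ X : (n : ℕ) → Fin n → ℝ, SemiDiscrete.IsNodeSystem γ X →
      ∀ f : ℝ → 𝕜, SemiDiscrete.IsLp p f →
      ∀ n : ℕ, 1 ≤ n →
        ENNReal.ofReal c *
            (SemiDiscrete.normDiscrete p (X n) (SemiDiscrete.steklov (γ / (n : ℝ)) r f - f) +
              SemiDiscrete.modulus s f (1 / (n : ℝ)) p) ≤
          SemiDiscrete.semiK p s (X n) f ∧
        SemiDiscrete.semiK p s (X n) f ≤
          ENNReal.ofReal C *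
            (SemiDiscrete.normDiscrete p (X n) (SemiDiscrete.steklov (γ / (n : ℝ)) r f - f) +
              SemiDiscrete.modulus s f (1 / (n : ℝ)) p) := by
  have hγ0 : 0 < γ := hγ.1
  set L : ℝ := 1 + 2 * r * 4 ^ r * γ⁻¹ + 4 ^ r * γ⁻¹ + 2 ^ s + s
  have hL0 : 0 < L := by positivity
  refine ⟨L⁻¹, 1 + (2 * r * 4 ^ r * γ⁻¹ + 1) + (4 ^ r * γ⁻¹ + 1) * (2 ^ s * (s + 2) ^ s),
    by positivity, by positivity, fun X hX f hf n hn => ⟨?_, ?_⟩⟩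
  · rw [ENNReal.ofReal_inv_of_pos hL0, ENNReal.inv_mul_le_iff (by simpa using hL0)
      ENNReal.ofReal_ne_top]
    exact SemiDiscrete.normDiscrete_add_modulus_le_semiK hp hr hs hsr hγ hX hf hn
  · exact SemiDiscrete.semiK_le_normDiscrete_add_modulus hp hr hs hsr hγ hX hf hn
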